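/- Let $\alpha,\beta,\gamma>0$ and let $A,B$ be real constants with $A\ge 0$, $A+B\ge 0$ and $(A,B)\neq(0,0)$. For $t\in(0,1)$ and $x\in[0,1]$ put $$w(x,t)=x^{\alpha}(1-x)^{\beta}|x-t|^{\gamma}\bigl(A+B\,\theta(x-t)\bigr),$$ where $\theta(x)=1$ for $x>0$ and $\theta(x)=0$ otherwise. Let $P_n(x,t)$, $n=0,1,2,\dots$, be the monic polynomials in $x$, with $\deg P_n=n$, that are orthogonal on $[0,1]$ with respect to $w(\cdot,t)$, and let $$h_n(t)=\int_0^1P_n(x,t)^2\,w(x,t)\,dx,\qquad R_n(t)=\frac{\beta}{h_n(t)}\int_0^1\frac{P_n(y,t)^2\,w(y,t)}{1-y}\,dy,$$ $$S_n(t)=\frac{(t-1)R_n(t)}{2n+\alpha+\beta+\gamma+1}+1 .$$ Then, for every $n\ge 0$, the function $S_n$ is twice continuously differentiable on $(0,1)$, never takes the values $0$ and $1$ there, the points $t\in(0,1)$ with $S_n(t)=t$ are isolated (they do not accumulate at any point of $(0,1)$), and at every $t\in(0,1)$ with $S_n(t)\ne t$ the function $S_n$ satisfies the Painlevé VI equation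 $$S_n''=\frac12\left(\frac1{S_n}+\frac1{S_n-1}+\frac1{S_n-t}\right)(S_n')^2-\left(\frac1t+\frac1{t-1}+\frac1{S_n-t}\right)S_n'$$ $$\qquad+\frac{S_n(S_n-1)(S_n-t)}{t^2(t-1)^2}\left(\mu_1+\frac{\mu_2t}{S_n^2}+\frac{\mu_3(t-1)}{(S_n-1)^2}+\frac{\mu_4t(t-1)}{(S_n-t)^2}\right)$$ with parameters $$\mu_1=\frac{(2n+\alpha+\beta+\gamma+1)^2}{2},\qquad\mu_2=-\frac{\alpha^2}{2},\qquad\mu_3=\frac{\beta^2}{2},\qquad\mu_4=\frac{1-\gamma^2}{2}.$$ -/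

import Mathlib

open MeasureTheory Set Filter Topology Polynomial

noncomputable section

/-- The Heaviside step function: `1` for `x > 0` and `0` otherwise. -/
def stepFn (x : ℝ) : ℝ := if 0 < x then 1 else 0

/-- The perturbed Jacobi weight
`w(x,t) = x^α (1-x)^β |x-t|^γ (A + B θ(x-t))` on `[0,1]`. -/
def jacobiWeight (α β γ A B t x : ℝ) : ℝ :=
  x ^ α * (1 - x) ^ β * |x - t| ^ γ * (A + B * stepFn (x - t))

/-- The bilinear form `(p, q) ↦ ∫₀¹ p(x) q(x) w(x) dx` on polynomials. -/
def weightForm (w : ℝ → ℝ) (p q : ℝ[X]) : ℝ :=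
  ∫ x in (0 : ℝ)..1, p.eval x * q.eval x * w x

/-- The monic orthogonal polynomials for the weight `w` on `[0,1]`, built by the Gram-Schmidt
process from `1, X, X², …`. -/
def monicOP (w : ℝ → ℝ) : ℕ → ℝ[X]
  | n => X ^ n - ∑ k : Fin n,
      C (weightForm w (X ^ n) (monicOP w k) / weightForm w (monicOP w k) (monicOP w k)) *
        monicOP w k
termination_by n => n
decreasing_by all_goals exact k.isLt

/-- `h_n(t) = ∫₀¹ P_n(x,t)² w(x,t) dx`. -/
def normSqOP (α β γ A B : ℝ) (n : ℕ) (t : ℝ) : ℝ :=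
  ∫ x in (0 : ℝ)..1,
    ((monicOP (jacobiWeight α β γ A B t) n).eval x) ^ 2 * jacobiWeight α β γ A B t x

/-- `R_n(t) = (β / h_n(t)) ∫₀¹ P_n(y,t)² w(y,t) / (1-y) dy`. -/
def auxR (α β γ A B : ℝ) (n : ℕ) (t : ℝ) : ℝ :=
  β / normSqOP α β γ A B n t *
    ∫ y in (0 : ℝ)..1,
      ((monicOP (jacobiWeight α β γ A B t) n).eval y) ^ 2 * jacobiWeight α β γ A B t y / (1 - y)

/-- `S_n(t) = (t-1) R_n(t) / (2n+α+β+γ+1) + 1`. -/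
def auxS (α β γ A B : ℝ) (n : ℕ) (t : ℝ) : ℝ :=
  (t - 1) * auxR α β γ A B n t / (2 * n + α + β + γ + 1) + 1

/-- The Painlevé VI equation with parameters `μ₁, μ₂, μ₃, μ₄` for the function `q` at the
point `t`; it is meaningful where `t ≠ 0, 1`, `q` is twice differentiable and
`q t ≠ 0, 1, t`. -/
def PainleveVIAt (μ₁ μ₂ μ₃ μ₄ : ℝ) (q : ℝ → ℝ) (t : ℝ) : Prop :=
  deriv (deriv q) t =
    1 / 2 * (1 / q t + 1 / (q t - 1) + 1 / (q t - t)) * (deriv q t) ^ 2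
      - (1 / t + 1 / (t - 1) + 1 / (q t - t)) * deriv q t
      + q t * (q t - 1) * (q t - t) / (t ^ 2 * (t - 1) ^ 2) *
        (μ₁ + μ₂ * t / (q t) ^ 2 + μ₃ * (t - 1) / (q t - 1) ^ 2
          + μ₄ * t * (t - 1) / (q t - t) ^ 2)

/-! The following facts confirm that `monicOP` is the family of monic orthogonal polynomials. -/

theorem monicOP_monic_natDegree (w : ℝ → ℝ) (n : ℕ) :
    (monicOP w n).Monic ∧ (monicOP w n).natDegree = n := by
  induction n using Nat.strong_induction_on with
  | _ n ih =>
    have hlt : (∑ k : Fin n,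
        C (weightForm w (X ^ n) (monicOP w k) / weightForm w (monicOP w k) (monicOP w k)) *
          monicOP w k).degree < (n : WithBot ℕ) := by
      refine lt_of_le_of_lt (degree_sum_le _ _) ?_
      refine (Finset.sup_lt_iff (WithBot.bot_lt_coe n)).2 ?_
      intro k _
      refine lt_of_le_of_lt degree_le_natDegree ?_
      refine lt_of_le_of_lt (Nat.cast_le.2 (natDegree_C_mul_le _ _)) ?_
      rw [(ih k k.isLt).2]
      exact Nat.cast_lt.2 k.isLt
    rw [monicOP]
    refine ⟨monic_X_pow_sub hlt, ?_⟩
    have h : (X ^ n - ∑ k : Fin n,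
        C (weightForm w (X ^ n) (monicOP w k) / weightForm w (monicOP w k) (monicOP w k)) *
          monicOP w k : ℝ[X]).degree = (X ^ n : ℝ[X]).degree :=
      degree_sub_eq_left_of_degree_lt (by rw [degree_X_pow]; exact hlt)
    rw [natDegree_eq_of_degree_eq h, natDegree_X_pow]

theorem weightForm_comm (w : ℝ → ℝ) (p q : ℝ[X]) : weightForm w p q = weightForm w q p := by
  unfold weightForm
  congr 1
  ext x
  ring

theorem weightForm_intervalIntegrable {w : ℝ → ℝ} (hw : IntervalIntegrable w volume 0 1)
    (p q : ℝ[X]) :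
    IntervalIntegrable (fun x => p.eval x * q.eval x * w x) volume 0 1 :=
  hw.continuousOn_mul (p.continuous.mul q.continuous).continuousOn

theorem weightForm_sub_sum {w : ℝ → ℝ} (hw : IntervalIntegrable w volume 0 1)
    {ι : Type*} (s : Finset ι) (p : ℝ[X]) (c : ι → ℝ) (f : ι → ℝ[X]) (q : ℝ[X]) :
    weightForm w (p - ∑ i ∈ s, C (c i) * f i) q =
      weightForm w p q - ∑ i ∈ s, c i * weightForm w (f i) q := by
  unfold weightForm
  have h1 : ∀ i ∈ s, IntervalIntegrable
      (fun x => c i * ((f i).eval x * q.eval x * w x)) volume 0 1 :=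
    fun i _ => (weightForm_intervalIntegrable hw (f i) q).const_mul (c i)
  simp_rw [← intervalIntegral.integral_const_mul]
  have h2 : IntervalIntegrable
      (fun x => ∑ i ∈ s, c i * ((f i).eval x * q.eval x * w x)) volume 0 1 := by
    simpa only [Finset.sum_fn] using IntervalIntegrable.sum s h1
  rw [← intervalIntegral.integral_finsetSum h1, ← intervalIntegral.integral_sub
    (weightForm_intervalIntegrable hw p q) h2]
  congr 1
  ext x
  simp only [eval_sub, eval_finsetSum, eval_mul, eval_C, sub_mul, Finset.sum_mul]
  congr 1
  exact Finset.sum_congr rfl fun i _ => by ring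

theorem weightForm_monicOP_eq_zero {w : ℝ → ℝ} (hw : IntervalIntegrable w volume 0 1)
    (h0 : ∀ n, weightForm w (monicOP w n) (monicOP w n) ≠ 0) {m n : ℕ} (hmn : m < n) :
    weightForm w (monicOP w n) (monicOP w m) = 0 := by
  induction n using Nat.strong_induction_on generalizing m with
  | _ n ih =>
    have hoff : ∀ k : Fin n, k ≠ ⟨m, hmn⟩ →
        weightForm w (monicOP w k) (monicOP w m) = 0 := by
      intro k hk
      rcases lt_trichotomy (k : ℕ) m with h | h | h
      · rw [weightForm_comm]
        exact ih m hmn h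
      · exact absurd (Fin.ext h) hk
      · exact ih k k.isLt h
    rw [monicOP, weightForm_sub_sum hw, Finset.sum_eq_single ⟨m, hmn⟩]
    · simp only
      rw [div_mul_cancel₀ _ (h0 m), sub_self]
    · intro k _ hk
      rw [hoff k hk, mul_zero]
    · intro h
      exact absurd (Finset.mem_univ _) h

theorem weightForm_self_pos {w : ℝ → ℝ} (hw : IntervalIntegrable w volume 0 1)
    (hnn : ∀ x ∈ Ioc (0 : ℝ) 1, 0 ≤ w x) {a b : ℝ} (ha : 0 ≤ a) (hab : a < b) (hb : b ≤ 1)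
    (hpos : ∀ x ∈ Ioo a b, w x ≠ 0) {p : ℝ[X]} (hp : p ≠ 0) :
    0 < weightForm w p p := by
  unfold weightForm
  rw [intervalIntegral.integral_pos_iff_support_of_nonneg_ae' _
    (weightForm_intervalIntegrable hw p p)]
  · refine ⟨one_pos, ?_⟩
    have hfin : volume {x : ℝ | p.IsRoot x} = 0 :=
      (Polynomial.finite_setOfPred_isRoot hp).measure_zero _
    have hsub : Ioo a b \ {x : ℝ | p.IsRoot x} ⊆
        Function.support (fun x => p.eval x * p.eval x * w x) ∩ Ioc 0 1 := by
      rintro x ⟨hx, hr⟩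
      have hr' : p.eval x ≠ 0 := hr
      exact ⟨mul_ne_zero (mul_ne_zero hr' hr') (hpos x hx),
        lt_of_le_of_lt ha hx.1, hx.2.le.trans hb⟩
    refine lt_of_lt_of_le ?_ (measure_mono hsub)
    rw [measure_sdiff_null hfin, Real.volume_Ioo]
    simpa using hab
  · rw [uIoc_of_le zero_le_one]
    refine (ae_restrict_iff' measurableSet_Ioc).2 (Eventually.of_forall fun x hx => ?_)
    exact mul_nonneg (mul_self_nonneg _) (hnn x hx)

theorem jacobiWeight_intervalIntegrable {α β γ : ℝ} (A B t : ℝ)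
    (hα : 0 < α) (hβ : 0 < β) (hγ : 0 < γ) :
    IntervalIntegrable (jacobiWeight α β γ A B t) volume 0 1 := by
  unfold jacobiWeight
  have hs : IntervalIntegrable (fun x => A + B * stepFn (x - t)) volume 0 1 := by
    refine (intervalIntegrable_const (c := A)).add (IntervalIntegrable.const_mul ?_ B)
    refine (intervalIntegrable_const (c := (1 : ℝ))).mono_fun ?_ ?_
    · refine Measurable.aestronglyMeasurable ?_
      exact Measurable.ite (measurableSet_lt measurable_const (measurable_id.sub_const t))
        measurable_const measurable_const
    · refine Eventually.of_forall fun x => ?_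
      by_cases h : 0 < x - t <;> simp [stepFn, h]
  refine hs.continuousOn_mul (Continuous.continuousOn ?_)
  refine ((continuous_id.rpow_const fun _ => Or.inr hα.le).mul
    ((continuous_const.sub continuous_id).rpow_const fun _ => Or.inr hβ.le)).mul
    ((continuous_id.sub continuous_const).abs.rpow_const fun _ => Or.inr hγ.le)

/-- For `α, β, γ > 0`, `A ≥ 0`, `A + B ≥ 0`, not both zero, and `0 < t < 1`, the `monicOP` are
monic of degree `n`, pairwise orthogonal, and of positive norm `h_n(t)`. -/
theorem monicOP_jacobiWeight {α β γ A B t : ℝ} (hα : 0 < α) (hβ : 0 < β) (hγ : 0 < γ)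
    (hA : 0 ≤ A) (hAB : 0 ≤ A + B) (hne : ¬(A = 0 ∧ B = 0)) (ht : t ∈ Ioo (0 : ℝ) 1) (n : ℕ) :
    (monicOP (jacobiWeight α β γ A B t) n).Monic ∧
    (monicOP (jacobiWeight α β γ A B t) n).natDegree = n ∧
    (∀ m, m ≠ n → weightForm (jacobiWeight α β γ A B t)
      (monicOP (jacobiWeight α β γ A B t) m) (monicOP (jacobiWeight α β γ A B t) n) = 0) ∧
    0 < normSqOP α β γ A B n t := by
  have hw := jacobiWeight_intervalIntegrable A B t hα hβ hγ
  have hnn : ∀ x ∈ Ioc (0 : ℝ) 1, 0 ≤ jacobiWeight α β γ A B t x := by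
    intro x hx
    have h1 : 0 ≤ x ^ α := Real.rpow_nonneg hx.1.le _
    have h2 : 0 ≤ (1 - x) ^ β := Real.rpow_nonneg (by linarith [hx.2]) _
    have h3 : 0 ≤ |x - t| ^ γ := Real.rpow_nonneg (abs_nonneg _) _
    have h4 : 0 ≤ A + B * stepFn (x - t) := by
      unfold stepFn
      split_ifs
      · simpa using hAB
      · simpa using hA
    exact mul_nonneg (mul_nonneg (mul_nonneg h1 h2) h3) h4
  have hfac : ∀ x ∈ Ioo (0 : ℝ) 1, x ≠ t → A + B * stepFn (x - t) ≠ 0 →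
      jacobiWeight α β γ A B t x ≠ 0 := by
    intro x hx hxt h4
    have h1 : 0 < x ^ α := Real.rpow_pos_of_pos hx.1 _
    have h2 : 0 < (1 - x) ^ β := Real.rpow_pos_of_pos (by linarith [hx.2]) _
    have h3 : 0 < |x - t| ^ γ := Real.rpow_pos_of_pos (abs_pos.2 (sub_ne_zero.2 hxt)) _
    exact mul_ne_zero (mul_pos (mul_pos h1 h2) h3).ne' h4
  have hpos : ∀ p : ℝ[X], p ≠ 0 → 0 < weightForm (jacobiWeight α β γ A B t) p p := by
    intro p hp
    by_cases hA0 : A = 0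
    · refine weightForm_self_pos hw hnn ht.1.le ht.2 le_rfl (fun x hx => ?_) hp
      refine hfac x ⟨ht.1.trans hx.1, hx.2⟩ hx.1.ne' ?_
      have hB0 : B ≠ 0 := fun h => hne ⟨hA0, h⟩
      simpa [stepFn, hA0, hx.1] using hB0
    · refine weightForm_self_pos hw hnn le_rfl ht.1 ht.2.le (fun x hx => ?_) hp
      refine hfac x ⟨hx.1, hx.2.trans ht.2⟩ hx.2.ne ?_
      simpa [stepFn, not_lt.2 hx.2.le] using hA0
  have hmd := monicOP_monic_natDegree (jacobiWeight α β γ A B t)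
  have h0 : ∀ k, weightForm (jacobiWeight α β γ A B t)
      (monicOP (jacobiWeight α β γ A B t) k) (monicOP (jacobiWeight α β γ A B t) k) ≠ 0 :=
    fun k => (hpos _ (hmd k).1.ne_zero).ne'
  refine ⟨(hmd n).1, (hmd n).2, fun m hm => ?_, ?_⟩
  · rcases lt_or_gt_of_ne hm with h | h
    · rw [weightForm_comm]
      exact weightForm_monicOP_eq_zero hw h0 h
    · exact weightForm_monicOP_eq_zero hw h0 h
  · have := hpos _ (hmd n).1.ne_zero
    simpa only [normSqOP, weightForm, sq] using this

end

/-! Write μ for integration against w, and L₀, L₁, L_t for integration against w/x, w/(x-1),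
w/(x-t). Put P = P_n, h = h_n, Q = P_{n-1}/h_{n-1} (Q = 0 when n = 0) and c = 2n+α+β+γ+1. For i = 0,
1, t, multiply L_i(PP)/h, L_i(PQ) and h L_i(QQ) by α, β, γ respectively. The resulting numbers a_i,
b_i, D_i (subscripts 0, 1, 2) carry the residues at 0, 1, t of the Lax matrix of Painlevé VI.

Three kinds of relations hold. Integrating (qw)' over [0,1] gives the Pearson identity
(`pearson_jacobiWeight`); applied to PP, PQ, QQ and to their multiples by X, it gives linear
relations, among them a₀+a₁+a₂ = 0, a₁+t a₂ = -c and D₀+D₁+D₂ = 0. Polynomial division by X-a gives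
a rank-one condition at each pole (`IsDualPair.cauchy_mul_cauchy`), for instance a₁D₁ = b₁(b₁-β).
Finally, dμ/dt = -γ L_t (`hasDerivAt_momentFun`), together with the expression of (X-t) ∂_t P and
(X-t) ∂_t Q through P and Q (`IsSemiclassical.X_sub_C_mul_timeDeriv`), gives Schlesinger equations
in t.

Since a₁ = -R_n, the function S_n equals t a₀/c, which is the zero of a₀/x + a₁/(x-1) + a₂/(x-t).
Positivity of w gives a₀ > 0 and a₁ < 0, hence 0 < S_n < 1. If S_n = t then a₂ = 0, so b₂ is 0 or γ,
and S_n' - 1 = γ - 2b₂ = ±γ is nonzero: such points are isolated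
(`IsSchlesingerSystem.eventually_ne`). Elsewhere every a_i is nonzero, the D_i can be eliminated,
and the defect in Painlevé VI is a multiple of D₀+D₁+D₂ (`painleveVI_algebra`). Smoothness is a
bootstrap: L_t(1) is a combination of two moments with smooth coefficients, so moments of class C^m
have C^m derivatives. -/

/-! ### Algebra of an orthogonal polynomial P and its dual Q -/

theorem exists_eq_X_sub_C_mul_add (a : ℝ) (q : ℝ[X]) :
    ∃ r : ℝ[X], q = (X - C a) * r + C (q.eval a) ∧
      (∀ n : ℕ, q.degree ≤ n → r.degree < n) ∧
      ∀ n : ℕ, q.degree ≤ (n + 1 : ℕ) → r.coeff n = q.coeff (n + 1) := by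
  have hq : q = (X - C a) * (q /ₘ (X - C a)) + C (q.eval a) := by
    conv_lhs => rw [← modByMonic_add_div q (X - C a)]
    rw [modByMonic_X_sub_C_eq_C_eval]
    ring
  have hdeg : ∀ n : ℕ, q.degree ≤ n → (q /ₘ (X - C a)).degree < n := by
    intro n hn
    by_cases h0 : q /ₘ (X - C a) = 0
    · rw [h0, degree_zero]
      exact WithBot.bot_lt_coe n
    · have hn' : q.natDegree ≤ n := natDegree_le_of_degree_le hn
      have h1 := natDegree_divByMonic q (monic_X_sub_C a)
      rw [natDegree_X_sub_C] at h1
      have h2 : 0 < q.natDegree := by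
        by_contra h
        apply h0
        rw [divByMonic_eq_zero_iff (monic_X_sub_C a), degree_X_sub_C]
        refine lt_of_le_of_lt degree_le_natDegree ?_
        have : q.natDegree = 0 := by omega
        rw [this]
        exact_mod_cast one_pos
      rw [← natDegree_lt_iff_degree_lt h0]
      omega
  refine ⟨q /ₘ (X - C a), hq, hdeg, fun n hn => ?_⟩
  have h1 : (q /ₘ (X - C a)).coeff (n + 1) = 0 := coeff_eq_zero_of_degree_lt (hdeg _ hn)
  conv_rhs => rw [hq]
  rw [sub_mul, coeff_add, coeff_sub, coeff_X_mul, coeff_C_mul, h1, coeff_C_succ]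
  ring

/-- `P` is the monic orthogonal polynomial of degree `n` for the functional `μ`, and `Q` is the
polynomial of degree less than `n` which represents the coefficient of degree `n - 1`. -/
structure IsDualPair (μ : ℝ[X] →ₗ[ℝ] ℝ) (n : ℕ) (P Q : ℝ[X]) : Prop where
  monic : P.Monic
  natDegree_eq : P.natDegree = n
  orthogonal : ∀ q : ℝ[X], q.degree < n → μ (P * q) = 0
  degree_lt : Q.degree < n
  dual : ∀ q : ℝ[X], q.degree < n → μ (Q * q) = q.coeff (n - 1)

namespace IsDualPair

variable {μ L : ℝ[X] →ₗ[ℝ] ℝ} {n : ℕ} {P Q : ℝ[X]} {a : ℝ}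

theorem degree_eq (h : IsDualPair μ n P Q) : P.degree = n := by
  rw [degree_eq_natDegree h.monic.ne_zero, h.natDegree_eq]

theorem coeff_eq_one (h : IsDualPair μ n P Q) : P.coeff n = 1 := by
  have := h.monic.coeff_natDegree
  rwa [h.natDegree_eq] at this

theorem eq_zero_of_degree_zero (h : IsDualPair μ 0 P Q) : Q = 0 := by
  have := h.degree_lt
  rwa [Nat.cast_zero, ← not_le, zero_le_degree_iff, not_not] at this

/-- In the division q = (X-a)r + q(a), the quotient r has degree below n, so its contribution μ(Pr)
vanishes. -/
theorem cauchy_mul_left (h : IsDualPair μ n P Q) (hL : ∀ q, L ((X - C a) * q) = μ q) {q : ℝ[X]}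
    (hq : q.degree ≤ n) : L (P * q) = q.eval a * L P := by
  obtain ⟨r, hr, hd, -⟩ := exists_eq_X_sub_C_mul_add a q
  have h1 : P * q = (X - C a) * (P * r) + (q.eval a) • P := by
    conv_lhs => rw [hr]
    rw [smul_eq_C_mul]
    ring
  rw [h1, map_add, hL, h.orthogonal r (hd n hq), map_smul, smul_eq_mul, zero_add]

/-- The same division, but now μ(Qr) reads off the top coefficient of r, which is that of q. Degree
zero is excluded: there Q = 0 and the coefficient term would be wrong. -/
theorem cauchy_dual_mul (h : IsDualPair μ (n + 1) P Q) (hL : ∀ q, L ((X - C a) * q) = μ q)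
    {q : ℝ[X]} (hq : q.degree ≤ (n + 1 : ℕ)) :
    L (Q * q) = q.coeff (n + 1) + q.eval a * L Q := by
  obtain ⟨r, hr, hd, hc⟩ := exists_eq_X_sub_C_mul_add a q
  have h1 : Q * q = (X - C a) * (Q * r) + (q.eval a) • Q := by
    conv_lhs => rw [hr]
    rw [smul_eq_C_mul]
    ring
  rw [h1, map_add, hL, h.dual r (hd _ hq), map_smul, smul_eq_mul, Nat.add_sub_cancel, hc n hq]

/-- L(PQ) has two evaluations, Q(a)L(P) and 1 + P(a)L(Q), while L(PP) = P(a)L(P) and L(QQ) =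
Q(a)L(Q). Both sides are therefore the same product of four numbers. This is the rank-one condition
on the residue at a. -/
theorem cauchy_mul_cauchy (h : IsDualPair μ n P Q) (hL : ∀ q, L ((X - C a) * q) = μ q) :
    L (P * P) * L (Q * Q) = L (P * Q) * (L (P * Q) - 1) := by
  cases n with
  | zero => simp [h.eq_zero_of_degree_zero]
  | succ n =>
    have h1 := h.cauchy_mul_left hL h.degree_eq.le
    have h2 := h.cauchy_mul_left hL h.degree_lt.le
    have h3 := h.cauchy_dual_mul hL h.degree_eq.le
    have h4 := h.cauchy_dual_mul hL h.degree_lt.le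
    rw [h.coeff_eq_one, mul_comm Q P] at h3
    rw [coeff_eq_zero_of_degree_lt h.degree_lt] at h4
    rw [h1, h4]
    linear_combination (- L (P * Q)) * h3 + (- P.eval a * L Q) * h2

theorem degree_derivative_lt (h : IsDualPair μ n P Q) : (derivative P).degree < n := by
  rw [← h.degree_eq]
  exact Polynomial.degree_derivative_lt h.monic.ne_zero

theorem degree_derivative_dual_lt (h : IsDualPair μ n P Q) : (derivative Q).degree < n :=
  lt_of_le_of_lt degree_derivative_le h.degree_lt

theorem degree_X_mul_derivative_dual_lt (h : IsDualPair μ n P Q) :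
    (X * derivative Q).degree < (n : WithBot ℕ) := by
  by_cases hQ : Q = 0
  · simp [hQ]
  refine lt_of_le_of_lt ?_ h.degree_lt
  rw [degree_le_iff_coeff_zero]
  intro m hm
  cases m with
  | zero => simp
  | succ m => rw [coeff_X_mul, coeff_derivative, coeff_eq_zero_of_degree_lt hm, zero_mul]

theorem degree_X_mul_derivative_sub_lt (h : IsDualPair μ n P Q) :
    (X * derivative P - (n : ℝ) • P).degree < (n : WithBot ℕ) := by
  rw [degree_lt_iff_coeff_zero]
  intro m hm
  rw [coeff_sub, coeff_smul, smul_eq_mul]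
  rcases hm.eq_or_lt with rfl | hm
  · rw [h.coeff_eq_one]
    cases n with
    | zero => simp
    | succ n => rw [coeff_X_mul, coeff_derivative, h.coeff_eq_one]; push_cast; ring
  · have h0 : P.coeff m = 0 := coeff_eq_zero_of_natDegree_lt (by rw [h.natDegree_eq]; exact hm)
    cases m with
    | zero => omega
    | succ m => rw [coeff_X_mul, coeff_derivative, h0]; ring

theorem mul_derivative (h : IsDualPair μ n P Q) : μ (P * derivative P) = 0 :=
  h.orthogonal _ h.degree_derivative_lt

theorem mul_X_mul_derivative (h : IsDualPair μ n P Q) :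
    μ (P * (X * derivative P)) = n * μ (P * P) := by
  have h1 := h.orthogonal _ h.degree_X_mul_derivative_sub_lt
  rw [mul_sub, map_sub, mul_smul_comm, map_smul, smul_eq_mul] at h1
  linarith

theorem dual_mul_derivative (h : IsDualPair μ n P Q) : μ (Q * derivative P) = n := by
  cases n with
  | zero => simp [h.eq_zero_of_degree_zero]
  | succ n =>
    rw [h.dual _ h.degree_derivative_lt, Nat.add_sub_cancel, coeff_derivative, h.coeff_eq_one]
    push_cast
    ring

theorem dual_mul_self (h : IsDualPair μ n P Q) : μ (Q * P) = 0 := by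
  rw [mul_comm]
  exact h.orthogonal _ h.degree_lt

theorem dual_mul_X_mul_derivative (h : IsDualPair μ (n + 1) P Q) :
    μ (Q * (X * derivative P)) = - P.coeff n := by
  have h1 := h.dual _ h.degree_X_mul_derivative_sub_lt
  rw [mul_sub, map_sub, mul_smul_comm, map_smul, smul_eq_mul, h.dual_mul_self,
    Nat.add_sub_cancel, coeff_sub, coeff_smul, smul_eq_mul, mul_zero, sub_zero] at h1
  rw [h1]
  cases n with
  | zero => simp
  | succ n => rw [coeff_X_mul, coeff_derivative]; push_cast; ring

theorem dual_mul_derivative_dual (h : IsDualPair μ n P Q) : μ (Q * derivative Q) = 0 := by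
  cases n with
  | zero => simp [h.eq_zero_of_degree_zero]
  | succ n =>
    rw [h.dual _ h.degree_derivative_dual_lt, Nat.add_sub_cancel, coeff_derivative,
      coeff_eq_zero_of_degree_lt h.degree_lt, zero_mul]

end IsDualPair

/-! ### Pearson equation and linear relations between residues -/

/-- The functionals `μ(q) = ∫ q w` and `L_a(q) = ∫ q w / (x - a)`, `a = 0, 1, t`, of a weight `w`
satisfying the Pearson equation `w' / w = α / x + β / (x - 1) + γ / (x - t)`. -/
structure IsSemiclassical (α β γ t : ℝ) (μ L₀ L₁ Lt : ℝ[X] →ₗ[ℝ] ℝ) : Prop where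
  cauchy_zero : ∀ q, L₀ ((X - C 0) * q) = μ q
  cauchy_one : ∀ q, L₁ ((X - C 1) * q) = μ q
  cauchy_t : ∀ q, Lt ((X - C t) * q) = μ q
  pearson : ∀ q, μ (derivative q) + α * L₀ q + β * L₁ q + γ * Lt q = 0

namespace IsSemiclassical

variable {α β γ t : ℝ} {μ L₀ L₁ Lt : ℝ[X] →ₗ[ℝ] ℝ}

theorem _root_.cauchy_X_mul {μ L : ℝ[X] →ₗ[ℝ] ℝ} {a : ℝ} (hL : ∀ q, L ((X - C a) * q) = μ q)
    (q : ℝ[X]) : L (X * q) = μ q + a * L q := by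
  rw [← hL, ← smul_eq_mul a, ← map_smul, ← map_add, smul_eq_C_mul]
  congr 1
  ring

/-- Testing the Pearson identity on Xq removes L₀, because the factor X cancels the pole at 0. -/
theorem pearson_X_mul (h : IsSemiclassical α β γ t μ L₀ L₁ Lt) (q : ℝ[X]) :
    μ (X * derivative q) + (1 + α + β + γ) * μ q + β * L₁ q + γ * t * Lt q = 0 := by
  have h1 := h.pearson (X * q)
  rw [derivative_mul, derivative_X, one_mul, map_add, cauchy_X_mul h.cauchy_zero,
    cauchy_X_mul h.cauchy_one, cauchy_X_mul h.cauchy_t] at h1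
  linarith

variable {n : ℕ} {P Q : ℝ[X]}

theorem sum_norm (h : IsSemiclassical α β γ t μ L₀ L₁ Lt) (hd : IsDualPair μ n P Q) :
    α * L₀ (P * P) + β * L₁ (P * P) + γ * Lt (P * P) = 0 := by
  have h1 := h.pearson (P * P)
  rw [derivative_mul, mul_comm (derivative P), map_add, hd.mul_derivative] at h1
  linarith

theorem sum_X_norm (h : IsSemiclassical α β γ t μ L₀ L₁ Lt) (hd : IsDualPair μ n P Q) :
    (2 * n + α + β + γ + 1) * μ (P * P) + β * L₁ (P * P) + t * (γ * Lt (P * P)) = 0 := by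
  have h1 := h.pearson_X_mul (P * P)
  have h2 : X * derivative (P * P) = (2 : ℝ) • (P * (X * derivative P)) := by
    rw [derivative_mul, smul_eq_C_mul, C_ofNat]
    ring
  rw [h2, map_smul, hd.mul_X_mul_derivative, smul_eq_mul] at h1
  linarith

theorem sum_mixed (h : IsSemiclassical α β γ t μ L₀ L₁ Lt) (hd : IsDualPair μ n P Q) :
    n + α * L₀ (P * Q) + β * L₁ (P * Q) + γ * Lt (P * Q) = 0 := by
  have h1 := h.pearson (P * Q)
  rw [derivative_mul, mul_comm (derivative P), map_add, hd.dual_mul_derivative,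
    hd.orthogonal _ hd.degree_derivative_dual_lt] at h1
  linarith

/-- This combination is the subleading coefficient of P, whose time derivative is easy to find. For
n = 0 the truncated index `n - 1` picks the leading coefficient 1, and the last term compensates. -/
theorem sum_X_mixed (h : IsSemiclassical α β γ t μ L₀ L₁ Lt) (hd : IsDualPair μ n P Q) :
    β * L₁ (P * Q) + t * (γ * Lt (P * Q)) = P.coeff (n - 1) - if n = 0 then 1 else 0 := by
  cases n with
  | zero => simp [hd.eq_zero_of_degree_zero, hd.coeff_eq_one]
  | succ n =>
    have h1 := h.pearson_X_mul (P * Q)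
    have h2 : X * derivative (P * Q) = Q * (X * derivative P) + P * (X * derivative Q) := by
      rw [derivative_mul]
      ring
    rw [h2, map_add, hd.dual_mul_X_mul_derivative,
      hd.orthogonal _ hd.degree_X_mul_derivative_dual_lt, hd.orthogonal _ hd.degree_lt] at h1
    rw [if_neg n.succ_ne_zero, Nat.add_sub_cancel]
    linarith

theorem sum_dual (h : IsSemiclassical α β γ t μ L₀ L₁ Lt) (hd : IsDualPair μ n P Q) :
    α * L₀ (Q * Q) + β * L₁ (Q * Q) + γ * Lt (Q * Q) = 0 := by
  have h1 := h.pearson (Q * Q)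
  rw [derivative_mul, mul_comm (derivative Q), map_add, hd.dual_mul_derivative_dual] at h1
  linarith

/-- The time derivative of `P` (`κ = 0`) and of `Q` (`κ = 1`). -/
theorem X_sub_C_mul_timeDeriv (h : IsSemiclassical α β γ t μ L₀ L₁ Lt)
    (hμ : ∀ q, μ (q * q) = 0 → q = 0) (hd : IsDualPair μ n P Q) {T T' : ℝ[X]} {κ : ℝ}
    (hT : ∀ q : ℝ[X], q.degree < n → μ (T * q) = κ * q.coeff (n - 1))
    (hdeg : T'.degree < n) (hT' : ∀ q : ℝ[X], q.degree < n → μ (T' * q) = γ * Lt (T * q)) :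
    (X - C t) * T' = (γ * Lt (T * Q)) • P + (γ * κ - γ * Lt (T * P)) • Q := by
  cases n with
  | zero =>
    have h0 : T' = 0 := by
      rwa [Nat.cast_zero, ← not_le, zero_le_degree_iff, not_not] at hdeg
    simp [h0, hd.eq_zero_of_degree_zero]
  | succ n =>
    set r := (X - C t) * T' - (γ * Lt (T * Q)) • P - (γ * κ - γ * Lt (T * P)) • Q with hr
    have hPn := hd.coeff_eq_one
    -- The multiple of P is forced by the top coefficient, which pairing with Q extracts.
    have hlead : T'.coeff n = γ * Lt (T * Q) := by
      have h1 := hd.dual T' hdeg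
      rw [Nat.add_sub_cancel] at h1
      rw [← h1, mul_comm, hT' Q hd.degree_lt]
    have hr_deg : r.degree < (n + 1 : ℕ) := by
      rw [degree_lt_iff_coeff_zero]
      intro m hm
      obtain ⟨m, rfl⟩ := Nat.exists_eq_add_of_le' hm
      have hQ : Q.coeff (m + n + 1) = 0 :=
        coeff_eq_zero_of_degree_lt (hd.degree_lt.trans_le (by exact_mod_cast hm))
      have hT : T'.coeff (m + n + 1) = 0 :=
        coeff_eq_zero_of_degree_lt (hdeg.trans_le (by exact_mod_cast hm))
      rw [← add_assoc] at *
      rw [hr, coeff_sub, coeff_sub, coeff_smul, coeff_smul, sub_mul, coeff_sub, coeff_X_mul,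
        coeff_C_mul, hQ, hT]
      cases m with
      | zero => simp [hPn, hlead]
      | succ m =>
        have hP : P.coeff (m + 1 + n + 1) = 0 :=
          coeff_eq_zero_of_natDegree_lt (by rw [hd.natDegree_eq]; omega)
        have hT2 : T'.coeff (m + 1 + n) = 0 :=
          coeff_eq_zero_of_degree_lt (hdeg.trans_le (by exact_mod_cast (by omega)))
        rw [hP, hT2]
        simp
    -- The remainder r has degree at most n, so orthogonality to that whole space yields μ(rr) = 0
    -- and hence r = 0.
    have hr_orth : ∀ q : ℝ[X], q.degree < (n + 1 : ℕ) → μ (r * q) = 0 := by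
      intro q hq
      -- The product (X-t)q may have degree n+1, where the hypothesis on T' no longer applies.
      -- Subtracting a multiple of P lowers the degree, and costs nothing against T' since P is
      -- orthogonal to it.
      set s := (X - C t) * q - (q.coeff n) • P with hs
      have hs_deg : s.degree < (n + 1 : ℕ) := by
        rw [degree_lt_iff_coeff_zero]
        intro m hm
        obtain ⟨m, rfl⟩ := Nat.exists_eq_add_of_le' hm
        have hq1 : q.coeff (m + n + 1) = 0 :=
          coeff_eq_zero_of_degree_lt (hq.trans_le (by exact_mod_cast hm))
        rw [← add_assoc] at *
        rw [hs, coeff_sub, coeff_smul, sub_mul, coeff_sub, coeff_X_mul, coeff_C_mul, hq1]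
        cases m with
        | zero => simp [hPn]
        | succ m =>
          have hP : P.coeff (m + 1 + n + 1) = 0 :=
            coeff_eq_zero_of_natDegree_lt (by rw [hd.natDegree_eq]; omega)
          have hq2 : q.coeff (m + 1 + n) = 0 :=
            coeff_eq_zero_of_degree_lt (hq.trans_le (by exact_mod_cast (by omega)))
          rw [hP, hq2]
          simp
      have h1 : μ (T' * s) = γ * (κ * q.coeff n) - q.coeff n * (γ * Lt (T * P)) := by
        rw [hT' s hs_deg, hs, mul_sub, map_sub, mul_smul_comm, map_smul, smul_eq_mul,
          mul_left_comm, h.cauchy_t, hT q hq, Nat.add_sub_cancel]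
        ring
      have h2 : r * q = T' * s + (q.coeff n) • (P * T') - (γ * Lt (T * Q)) • (P * q)
          - (γ * κ - γ * Lt (T * P)) • (Q * q) := by
        simp only [hr, hs, smul_eq_C_mul]
        ring
      rw [h2, map_sub, map_sub, map_add, map_smul, map_smul, map_smul, h1, hd.orthogonal _ hdeg,
        hd.orthogonal _ hq, hd.dual _ hq, Nat.add_sub_cancel]
      simp only [smul_eq_mul]
      ring
    have h0 : r = 0 := hμ r (hr_orth r hr_deg)
    rw [hr, sub_sub, sub_eq_zero] at h0
    exact h0

end IsSemiclassical

/-! ### Differentiation in t and the Schlesinger equations -/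

/-- The coefficients of the polynomials `P s`, of bounded degree, have at `s = t` the derivatives
given by the coefficients of `P'`. -/
structure HasPolyDerivAt (P : ℝ → ℝ[X]) (P' : ℝ[X]) (t : ℝ) : Prop where
  bounded : ∃ N : ℕ, ∀ s, (P s).natDegree ≤ N
  coeff : ∀ k, HasDerivAt (fun s => (P s).coeff k) (P'.coeff k) t

theorem hasPolyDerivAt_const (q : ℝ[X]) (t : ℝ) : HasPolyDerivAt (fun _ => q) 0 t :=
  ⟨⟨q.natDegree, fun _ => le_rfl⟩, fun k => by simpa using hasDerivAt_const t (q.coeff k)⟩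

theorem HasPolyDerivAt.mul {P Q : ℝ → ℝ[X]} {P' Q' : ℝ[X]} {t : ℝ} (hP : HasPolyDerivAt P P' t)
    (hQ : HasPolyDerivAt Q Q' t) :
    HasPolyDerivAt (fun s => P s * Q s) (P' * Q t + P t * Q') t := by
  obtain ⟨⟨N, hN⟩, hPc⟩ := hP
  obtain ⟨⟨M, hM⟩, hQc⟩ := hQ
  refine ⟨⟨N + M, fun s => natDegree_mul_le.trans (add_le_add (hN s) (hM s))⟩, fun k => ?_⟩
  simp only [coeff_add, coeff_mul, ← Finset.sum_add_distrib]
  exact HasDerivAt.fun_sum fun i _ => (hPc i.1).mul (hQc i.2)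

theorem map_eq_sum_range {Φ : ℝ[X] →ₗ[ℝ] ℝ} {q : ℝ[X]} {N : ℕ} (hN : q.natDegree ≤ N) :
    Φ q = ∑ k ∈ Finset.range (N + 1), q.coeff k * Φ (X ^ k) := by
  conv_lhs => rw [as_sum_range' q (N + 1) (Nat.lt_succ_of_le hN)]
  rw [map_sum]
  refine Finset.sum_congr rfl fun k _ => ?_
  rw [← C_mul_X_pow_eq_monomial, ← smul_eq_C_mul, map_smul, smul_eq_mul]

theorem HasPolyDerivAt.map {P : ℝ → ℝ[X]} {P' : ℝ[X]} {t : ℝ} (hP : HasPolyDerivAt P P' t)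
    {Φ : ℝ → ℝ[X] →ₗ[ℝ] ℝ} {Φ' : ℝ[X] →ₗ[ℝ] ℝ}
    (hΦ : ∀ q, HasDerivAt (fun s => Φ s q) (Φ' q) t) :
    HasDerivAt (fun s => Φ s (P s)) (Φ' (P t) + Φ t P') t := by
  obtain ⟨⟨N, hN⟩, hPc⟩ := hP
  have hN' : P'.natDegree ≤ N := by
    rw [natDegree_le_iff_coeff_eq_zero]
    intro k hk
    refine (hPc k).unique ?_
    have : (fun s => (P s).coeff k) = fun _ => 0 :=
      funext fun s => coeff_eq_zero_of_natDegree_lt ((hN s).trans_lt hk)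
    rw [this]
    exact hasDerivAt_const t 0
  simp_rw [fun s => map_eq_sum_range (Φ := Φ s) (hN s)]
  rw [map_eq_sum_range (Φ := Φ') (hN t), map_eq_sum_range (Φ := Φ t) hN', ← Finset.sum_add_distrib]
  refine HasDerivAt.fun_sum fun k _ => ?_
  rw [add_comm]
  exact (hPc k).mul (hΦ _)

section Schlesinger

variable {α β γ t : ℝ} {μ L₁ : ℝ → ℝ[X] →ₗ[ℝ] ℝ} {L₀ Lt : ℝ[X] →ₗ[ℝ] ℝ} {n : ℕ}
  {P Q : ℝ → ℝ[X]} {P' Q' : ℝ[X]}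

theorem timeDeriv_degree_lt (hd : ∀ᶠ s in 𝓝 t, IsDualPair (μ s) n (P s) (Q s))
    (hP : HasPolyDerivAt P P' t) : P'.degree < n := by
  rw [degree_lt_iff_coeff_zero]
  intro m hm
  refine (hP.coeff m).unique ?_
  refine (hasDerivAt_const t (if m = n then (1 : ℝ) else 0)).congr_of_eventuallyEq ?_
  filter_upwards [hd] with s hs
  split_ifs with h
  · rw [h, hs.coeff_eq_one]
  · exact coeff_eq_zero_of_natDegree_lt (by rw [hs.natDegree_eq]; omega)

theorem timeDeriv_dual_degree_lt (hd : ∀ᶠ s in 𝓝 t, IsDualPair (μ s) n (P s) (Q s))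
    (hQ : HasPolyDerivAt Q Q' t) : Q'.degree < n := by
  rw [degree_lt_iff_coeff_zero]
  intro m hm
  refine (hQ.coeff m).unique ((hasDerivAt_const t (0 : ℝ)).congr_of_eventuallyEq ?_)
  filter_upwards [hd] with s hs
  exact coeff_eq_zero_of_degree_lt (hs.degree_lt.trans_le (by exact_mod_cast hm))

variable (hμ' : ∀ q, HasDerivAt (fun s => μ s q) (((-γ) • Lt) q) t)
include hμ'

/-- Differentiating a pairing that stays constant near t makes the contribution of T' cancel the
contribution of the moving functional. -/
theorem map_timeDeriv {T : ℝ → ℝ[X]} {T' q : ℝ[X]} {κ : ℝ} (hT : HasPolyDerivAt T T' t)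
    (h : ∀ᶠ s in 𝓝 t, μ s (T s * q) = κ) : μ t (T' * q) = γ * Lt (T t * q) := by
  have h1 := (hT.mul (hasPolyDerivAt_const q t)).map hμ'
  have h2 := h1.unique ((hasDerivAt_const t κ).congr_of_eventuallyEq h)
  rw [mul_zero, add_zero, LinearMap.smul_apply, smul_eq_mul] at h2
  linarith

variable (hd : ∀ᶠ s in 𝓝 t, IsDualPair (μ s) n (P s) (Q s)) (hP : HasPolyDerivAt P P' t)
include hd hP

theorem map_timeDeriv_mul {q : ℝ[X]} (hq : q.degree < n) :
    μ t (P' * q) = γ * Lt (P t * q) :=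
  map_timeDeriv (κ := 0) hμ' hP (hd.mono fun _ hs => hs.orthogonal q hq)

/-- The leading coefficient of P is fixed, so its derivative has lower degree and is orthogonal to
P; only the functional contributes. -/
theorem hasDerivAt_norm :
    HasDerivAt (fun s => μ s (P s * P s)) (-(γ * Lt (P t * P t))) t := by
  have h1 := (hP.mul hP).map hμ'
  have h2 := hd.self_of_nhds.orthogonal _ (timeDeriv_degree_lt hd hP)
  rw [mul_comm P', map_add, h2, LinearMap.smul_apply, smul_eq_mul] at h1
  convert h1 using 1
  ring

theorem hasDerivAt_subleading :
    HasDerivAt (fun s => (P s).coeff (n - 1)) (γ * Lt (P t * Q t)) t := by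
  have h1 := hP.coeff (n - 1)
  have h := hd.self_of_nhds
  rwa [← h.dual P' (timeDeriv_degree_lt hd hP), mul_comm (Q t),
    map_timeDeriv_mul hμ' hd hP h.degree_lt] at h1

variable (hpos : ∀ q, μ t (q * q) = 0 → q = 0) (hs : IsSemiclassical α β γ t (μ t) L₀ (L₁ t) Lt)
include hpos hs

theorem X_sub_C_mul_timeDeriv_left :
    (X - C t) * P' = (γ * Lt (P t * Q t)) • P t + (-(γ * Lt (P t * P t))) • Q t := by
  have h := hs.X_sub_C_mul_timeDeriv hpos hd.self_of_nhds (κ := 0)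
    (fun q hq => by rw [hd.self_of_nhds.orthogonal q hq, zero_mul])
    (timeDeriv_degree_lt hd hP) (fun q hq => map_timeDeriv_mul hμ' hd hP hq)
  rwa [mul_zero, zero_sub] at h

variable (hQ : HasPolyDerivAt Q Q' t)

omit hP in
include hQ in
theorem X_sub_C_mul_timeDeriv_right :
    (X - C t) * Q' =
      (γ * Lt (Q t * Q t)) • P t + (γ - γ * Lt (P t * Q t)) • Q t := by
  have h := hs.X_sub_C_mul_timeDeriv hpos hd.self_of_nhds (κ := 1)
    (fun q hq => by rw [hd.self_of_nhds.dual q hq, one_mul])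
    (timeDeriv_dual_degree_lt hd hQ)
    (fun q hq => map_timeDeriv (κ := q.coeff (n - 1)) hμ' hQ
      (hd.mono fun _ hs => hs.dual q hq))
  rwa [mul_one, mul_comm (Q t) (P t)] at h

-- Since 1-t = (X-t) - (X-1), this reduces L₁ of a time derivative to L₁ of (X-t) times it, which is
-- a known combination of P and Q.
omit hμ' hd hP hpos in
theorem IsSemiclassical.cauchy_one_timeDeriv (q r : ℝ[X]) :
    (1 - t) * L₁ t (q * r) = L₁ t ((X - C t) * q * r) - μ t (q * r) := by
  rw [← hs.cauchy_one, ← smul_eq_mul, ← map_smul, ← map_sub, smul_eq_C_mul]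
  congr 1
  rw [C_sub]
  ring

variable (ht : 1 - t ≠ 0)
  (hL' : ∀ q, HasDerivAt (fun s => L₁ s q) (((-γ / (1 - t)) • (L₁ t - Lt)) q) t)
include ht hL'

theorem hasDerivAt_cauchy_one_norm :
    HasDerivAt (fun s => L₁ s (P s * P s))
      ((2 * γ * (Lt (P t * Q t) * L₁ t (P t * P t) - Lt (P t * P t) * L₁ t (P t * Q t))
        - γ * (L₁ t (P t * P t) - Lt (P t * P t))) / (1 - t)) t := by
  have h1 := (hP.mul hP).map hL'
  have h2 := hd.self_of_nhds.orthogonal _ (timeDeriv_degree_lt hd hP)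
  have h3 := hs.cauchy_one_timeDeriv P' (P t)
  rw [X_sub_C_mul_timeDeriv_left hμ' hd hP hpos hs, mul_comm P', h2, add_mul, map_add,
    smul_mul_assoc, smul_mul_assoc, map_smul, map_smul, mul_comm (Q t)] at h3
  rw [mul_comm P', map_add, LinearMap.smul_apply, LinearMap.sub_apply] at h1
  simp only [smul_eq_mul] at h1 h3
  convert h1 using 1
  rw [div_eq_iff ht]
  field_simp
  linear_combination (-2) * h3

include hQ in
theorem hasDerivAt_cauchy_one_mixed :
    HasDerivAt (fun s => L₁ s (P s * Q s))
      (γ * (Lt (Q t * Q t) * L₁ t (P t * P t) - Lt (P t * P t) * L₁ t (Q t * Q t)) / (1 - t))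
      t := by
  have h1 := (hP.mul hQ).map hL'
  have h2 := hd.self_of_nhds.orthogonal _ (timeDeriv_dual_degree_lt hd hQ)
  have h3 := hs.cauchy_one_timeDeriv P' (Q t)
  have h4 := hs.cauchy_one_timeDeriv Q' (P t)
  rw [X_sub_C_mul_timeDeriv_left hμ' hd hP hpos hs, add_mul, map_add,
    map_timeDeriv_mul hμ' hd hP hd.self_of_nhds.degree_lt,
    smul_mul_assoc, smul_mul_assoc, map_smul, map_smul] at h3
  rw [X_sub_C_mul_timeDeriv_right hμ' hd hpos hs hQ, mul_comm Q', h2, add_mul, map_add,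
    smul_mul_assoc, smul_mul_assoc, map_smul, map_smul, mul_comm (Q t) (P t)] at h4
  rw [map_add, LinearMap.smul_apply, LinearMap.sub_apply] at h1
  simp only [smul_eq_mul] at h1 h3 h4
  convert h1 using 1
  rw [div_eq_iff ht]
  field_simp
  linear_combination -h3 - h4

end Schlesinger

/-! ### The weight and its Cauchy functionals -/

noncomputable section

/-- The factor `|u|^γ (A + B θ(u))` of the weight. -/
def stepPow (γ A B u : ℝ) : ℝ := |u| ^ γ * (A + B * stepFn u)

section StepPow

variable {γ : ℝ} (A B : ℝ)

theorem continuous_stepPow (hγ : 0 < γ) : Continuous (stepPow γ A B) := by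
  -- The jump of the step function is absorbed by max(u,0)^γ, which is continuous because γ > 0.
  have h : stepPow γ A B = fun u => A * |u| ^ γ + B * (max u 0) ^ γ := by
    funext u
    rcases lt_or_ge 0 u with hu | hu
    · simp only [stepPow, stepFn, if_pos hu, max_eq_left hu.le, abs_of_pos hu]
      ring
    · simp only [stepPow, stepFn, if_neg hu.not_gt, max_eq_right hu, Real.zero_rpow hγ.ne']
      ring
  rw [h]
  exact (continuous_const.mul (continuous_abs.rpow_const fun _ => Or.inr hγ.le)).add
    (continuous_const.mul ((continuous_id.max continuous_const).rpow_const fun _ => Or.inr hγ.le))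

theorem hasDerivAt_stepPow {u : ℝ} (hu : u ≠ 0) :
    HasDerivAt (stepPow γ A B) (γ * (stepPow γ A B u / u)) u := by
  rcases lt_or_gt_of_ne hu with h | h
  · have h1 : HasDerivAt (fun x : ℝ => (-x) ^ γ * A) (-1 * γ * (-u) ^ (γ - 1) * A) u :=
      ((hasDerivAt_neg u).rpow_const (Or.inl (neg_ne_zero.2 hu))).mul_const A
    have h2 : stepPow γ A B =ᶠ[𝓝 u] fun x : ℝ => (-x) ^ γ * A := by
      filter_upwards [gt_mem_nhds h] with x hx
      simp [stepPow, stepFn, not_lt.2 hx.le, abs_of_neg hx]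
    refine (h1.congr_of_eventuallyEq h2).congr_deriv ?_
    rw [h2.self_of_nhds, Real.rpow_sub_one (neg_ne_zero.2 hu)]
    field_simp
  · have h1 : HasDerivAt (fun x : ℝ => x ^ γ * (A + B)) (1 * γ * u ^ (γ - 1) * (A + B)) u :=
      ((hasDerivAt_id u).rpow_const (Or.inl hu)).mul_const (A + B)
    have h2 : stepPow γ A B =ᶠ[𝓝 u] fun x : ℝ => x ^ γ * (A + B) := by
      filter_upwards [lt_mem_nhds h] with x hx
      simp [stepPow, stepFn, hx, abs_of_pos hx]
    refine (h1.congr_of_eventuallyEq h2).congr_deriv ?_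
    rw [h2.self_of_nhds, Real.rpow_sub_one hu]
    field_simp

theorem intervalIntegrable_abs_rpow {r : ℝ} (hr : -1 < r) (a b : ℝ) :
    IntervalIntegrable (fun u : ℝ => |u| ^ r) volume a b := by
  have h : ∀ x, IntervalIntegrable (fun u : ℝ => |u| ^ r) volume 0 x := by
    intro x
    refine intervalIntegrable_of_even (by simp) (fun x hx => ?_)
    refine (intervalIntegral.intervalIntegrable_rpow' hr (a := 0) (b := x)).congr_uIoo
      fun u hu => ?_
    rw [uIoo_of_le hx.le] at hu
    simp only [abs_of_pos hu.1]
  exact (h a).symm.trans (h b)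

/-- The quotient is dominated by a constant times |u|^(γ-1), whose exponent exceeds -1. -/
theorem intervalIntegrable_stepPow_div (hγ : 0 < γ) (a b : ℝ) :
    IntervalIntegrable (fun u => stepPow γ A B u / u) volume a b := by
  refine ((intervalIntegrable_abs_rpow (r := γ - 1) (by linarith) a b).const_mul
    (|A| + |B|)).mono_fun ?_ ?_
  · exact ((continuous_stepPow A B hγ).measurable.div measurable_id).aestronglyMeasurable
  · refine Eventually.of_forall fun u => ?_
    rcases eq_or_ne u 0 with rfl | hu
    · simp only [div_zero, norm_zero]
      positivity
    have h1 : |A + B * stepFn u| ≤ |A| + |B| := by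
      refine (abs_add_le _ _).trans (add_le_add_right ?_ _)
      unfold stepFn
      split_ifs <;> simp
    have h2 : 0 ≤ |u| ^ γ := Real.rpow_nonneg (abs_nonneg u) _
    have h3 : 0 ≤ |u| ^ (γ - 1) := Real.rpow_nonneg (abs_nonneg u) _
    simp only [Real.norm_eq_abs, stepPow, abs_div, abs_mul, abs_of_nonneg h2, abs_of_nonneg h3]
    rw [abs_of_nonneg (by positivity : 0 ≤ |A| + |B|), Real.rpow_sub_one (abs_ne_zero.2 hu),
      mul_div_right_comm, mul_comm (|A| + |B|)]
    gcongr

end StepPow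

/-- The Jacobi factor `x^α (1-x)^β` extended by zero outside `[0,1]`. -/
def jacobiFactor (α β x : ℝ) : ℝ := (max x 0) ^ α * (max (1 - x) 0) ^ β

section Weight

variable {α β γ : ℝ} (A B t : ℝ)

theorem continuous_jacobiFactor (hα : 0 < α) (hβ : 0 < β) : Continuous (jacobiFactor α β) :=
  ((continuous_id.max continuous_const).rpow_const fun _ => Or.inr hα.le).mul
    (((continuous_const.sub continuous_id).max continuous_const).rpow_const fun _ => Or.inr hβ.le)

theorem jacobiFactor_eq_zero (hα : 0 < α) (hβ : 0 < β) {x : ℝ} (hx : x ∉ Ioo (0 : ℝ) 1) :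
    jacobiFactor α β x = 0 := by
  rw [mem_Ioo, not_and_or, not_lt, not_lt] at hx
  rcases hx with h | h
  · simp [jacobiFactor, max_eq_right h, Real.zero_rpow hα.ne']
  · simp [jacobiFactor, max_eq_right (sub_nonpos.2 h), Real.zero_rpow hβ.ne']

theorem jacobiWeight_eq {x : ℝ} (hx : x ∈ Icc (0 : ℝ) 1) :
    jacobiWeight α β γ A B t x = jacobiFactor α β x * stepPow γ A B (x - t) := by
  rw [jacobiWeight, jacobiFactor, stepPow, max_eq_left hx.1, max_eq_left (sub_nonneg.2 hx.2)]
  ring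

theorem intervalIntegrable_jacobiWeight_div_zero (hα : 0 < α) (hβ : 0 < β) (hγ : 0 < γ) :
    IntervalIntegrable (fun x => jacobiWeight α β γ A B t x / (x - 0)) volume 0 1 := by
  have h1 := (intervalIntegral.intervalIntegrable_rpow' (r := α - 1) (by linarith)
    (a := 0) (b := 1)).mul_continuousOn
    (g := fun x => (1 - x) ^ β * stepPow γ A B (x - t)) (Continuous.continuousOn
    (((continuous_const.sub continuous_id).rpow_const fun _ => Or.inr hβ.le).mul
      ((continuous_stepPow A B hγ).comp (continuous_id.sub continuous_const))))
  refine h1.congr_uIoo fun x hx => ?_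
  rw [uIoo_of_le zero_le_one] at hx
  simp only [jacobiWeight, stepPow, Real.rpow_sub_one hx.1.ne', sub_zero]
  ring

theorem intervalIntegrable_jacobiWeight_div_one (hα : 0 < α) (hβ : 0 < β) (hγ : 0 < γ) :
    IntervalIntegrable (fun x => jacobiWeight α β γ A B t x / (x - 1)) volume 0 1 := by
  have h0 := ((intervalIntegral.intervalIntegrable_rpow' (r := β - 1) (by linarith)
    (a := 0) (b := 1)).comp_sub_left 1).symm
  rw [sub_zero, sub_self] at h0
  have h1 := h0.mul_continuousOn
    (g := fun x => -(x ^ α * stepPow γ A B (x - t))) (Continuous.continuousOn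
    ((continuous_id.rpow_const fun _ => Or.inr hα.le).mul
      ((continuous_stepPow A B hγ).comp (continuous_id.sub continuous_const))).neg)
  refine h1.congr_uIoo fun x hx => ?_
  rw [uIoo_of_le zero_le_one] at hx
  have h2 : 1 - x ≠ 0 := (sub_pos.2 hx.2).ne'
  have h3 : x - 1 ≠ 0 := (sub_neg.2 hx.2).ne
  simp only [jacobiWeight, stepPow, Real.rpow_sub_one h2]
  field_simp
  ring

theorem intervalIntegrable_jacobiWeight_div_t (hα : 0 < α) (hβ : 0 < β) (hγ : 0 < γ) :
    IntervalIntegrable (fun x => jacobiWeight α β γ A B t x / (x - t)) volume 0 1 := by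
  have h0 := (intervalIntegrable_stepPow_div A B hγ (0 - t) (1 - t)).comp_sub_right t
  rw [sub_add_cancel, sub_add_cancel] at h0
  have h1 := h0.continuousOn_mul (continuous_jacobiFactor hα hβ).continuousOn
  refine h1.congr fun x hx => ?_
  rw [uIoc_of_le zero_le_one] at hx
  simp only [jacobiWeight_eq A B t (Ioc_subset_Icc_self hx)]
  ring

/-- The functional `q ↦ ∫₀¹ q(x) g(x) dx` on polynomials. -/
def polyIntegral (g : ℝ → ℝ) (hg : IntervalIntegrable g volume 0 1) : ℝ[X] →ₗ[ℝ] ℝ where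
  toFun q := ∫ x in (0 : ℝ)..1, q.eval x * g x
  map_add' p q := by
    rw [← intervalIntegral.integral_add (hg.continuousOn_mul p.continuous.continuousOn)
      (hg.continuousOn_mul q.continuous.continuousOn)]
    simp only [eval_add, add_mul]
  map_smul' c p := by
    simp only [eval_smul, smul_eq_mul, RingHom.id_apply, mul_assoc,
      intervalIntegral.integral_const_mul]

variable (hα : 0 < α) (hβ : 0 < β) (hγ : 0 < γ)

/-- `q ↦ ∫₀¹ q w`. -/
def momentFun (t : ℝ) : ℝ[X] →ₗ[ℝ] ℝ :=
  polyIntegral _ (jacobiWeight_intervalIntegrable A B t hα hβ hγ)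

/-- `q ↦ ∫₀¹ q(x) w(x) / x dx`. -/
def cauchyZero (t : ℝ) : ℝ[X] →ₗ[ℝ] ℝ :=
  polyIntegral _ (intervalIntegrable_jacobiWeight_div_zero A B t hα hβ hγ)

/-- `q ↦ ∫₀¹ q(x) w(x) / (x - 1) dx`. -/
def cauchyOne (t : ℝ) : ℝ[X] →ₗ[ℝ] ℝ :=
  polyIntegral _ (intervalIntegrable_jacobiWeight_div_one A B t hα hβ hγ)

/-- `q ↦ ∫₀¹ q(x) w(x) / (x - t) dx`. -/
def cauchyT (t : ℝ) : ℝ[X] →ₗ[ℝ] ℝ :=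
  polyIntegral _ (intervalIntegrable_jacobiWeight_div_t A B t hα hβ hγ)

theorem polyIntegral_div_mul {w : ℝ → ℝ} {a : ℝ} (hw : IntervalIntegrable w volume 0 1)
    (hwa : IntervalIntegrable (fun x => w x / (x - a)) volume 0 1) (q : ℝ[X]) :
    polyIntegral _ hwa ((X - C a) * q) = polyIntegral _ hw q := by
  refine intervalIntegral.integral_congr_ae ?_
  have h : ∀ᵐ x : ℝ, x ≠ a := by simp [ae_iff]
  filter_upwards [h] with x hx _
  have := sub_ne_zero.2 hx
  simp only [eval_mul, eval_sub, eval_X, eval_C]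
  field_simp

/-- This is the fundamental theorem of calculus for qw on [0,1]. The boundary terms vanish because
α, β > 0; at x = t differentiability may fail, but continuity and integrability of the derivative
suffice away from a countable set. -/
theorem pearson_jacobiWeight (q : ℝ[X]) :
    momentFun A B hα hβ hγ t (derivative q) + α * cauchyZero A B hα hβ hγ t q
      + β * cauchyOne A B hα hβ hγ t q + γ * cauchyT A B hα hβ hγ t q = 0 := by
  have hw := jacobiWeight_intervalIntegrable A B t hα hβ hγ
  have i0 := intervalIntegrable_jacobiWeight_div_zero A B t hα hβ hγ
  have i1 := intervalIntegrable_jacobiWeight_div_one A B t hα hβ hγ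
  have i2 := intervalIntegrable_jacobiWeight_div_t A B t hα hβ hγ
  have j := (hw.continuousOn_mul (derivative q).continuous.continuousOn)
  have j0 := (i0.continuousOn_mul q.continuous.continuousOn).const_mul α
  have j1 := (i1.continuousOn_mul q.continuous.continuousOn).const_mul β
  have j2 := (i2.continuousOn_mul q.continuous.continuousOn).const_mul γ
  have hcont : Continuous (fun x => q.eval x * jacobiWeight α β γ A B t x) := by
    refine q.continuous.mul ?_
    have h : jacobiWeight α β γ A B t =
        fun x => x ^ α * (1 - x) ^ β * stepPow γ A B (x - t) := by
      funext x
      simp only [jacobiWeight, stepPow, mul_assoc]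
    rw [h]
    exact ((continuous_id.rpow_const fun _ => Or.inr hα.le).mul
      ((continuous_const.sub continuous_id).rpow_const fun _ => Or.inr hβ.le)).mul
      ((continuous_stepPow A B hγ).comp (continuous_id.sub continuous_const))
  have hder := integral_eq_of_hasDerivAt_off_countable_of_le _ _ zero_le_one
    (countable_singleton t) hcont.continuousOn (fun x hx => ?_) (((j.add j0).add j1).add j2)
  · rw [intervalIntegral.integral_add ((j.add j0).add j1) j2,
      intervalIntegral.integral_add (j.add j0) j1, intervalIntegral.integral_add j j0,
      intervalIntegral.integral_const_mul, intervalIntegral.integral_const_mul,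
      intervalIntegral.integral_const_mul] at hder
    refine hder.trans ?_
    simp [jacobiWeight, Real.zero_rpow hα.ne', Real.zero_rpow hβ.ne']
  · obtain ⟨⟨h0, h1⟩, ht⟩ := hx
    have ht' : x - t ≠ 0 := sub_ne_zero.2 ht
    have h1' : 1 - x ≠ 0 := (sub_pos.2 h1).ne'
    have h1'' : x - 1 ≠ 0 := (sub_neg.2 h1).ne
    have d0 : HasDerivAt (fun y : ℝ => y ^ α) (1 * α * x ^ (α - 1)) x :=
      (hasDerivAt_id x).rpow_const (Or.inl h0.ne')
    have d1 : HasDerivAt (fun y : ℝ => (1 - y) ^ β) (-1 * β * (1 - x) ^ (β - 1)) x :=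
      ((hasDerivAt_id x).const_sub 1).rpow_const (Or.inl h1')
    have d2 : HasDerivAt (fun y => stepPow γ A B (y - t))
        (γ * (stepPow γ A B (x - t) / (x - t))) x :=
      (hasDerivAt_stepPow A B ht').comp_sub_const x t
    have d := (q.hasDerivAt x).mul ((d0.mul d1).mul d2)
    refine (d.congr_deriv ?_).congr_of_eventuallyEq (Eventually.of_forall fun y => ?_)
    · simp only [jacobiWeight, stepPow, Real.rpow_sub_one h0.ne', Real.rpow_sub_one h1', sub_zero,
        Pi.mul_apply]
      field_simp
      ring
    · simp only [jacobiWeight, stepPow, Pi.mul_apply]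
      ring

theorem isSemiclassical_jacobiWeight :
    IsSemiclassical α β γ t (momentFun A B hα hβ hγ t) (cauchyZero A B hα hβ hγ t)
      (cauchyOne A B hα hβ hγ t) (cauchyT A B hα hβ hγ t) where
  cauchy_zero := polyIntegral_div_mul _ _
  cauchy_one := polyIntegral_div_mul _ _
  cauchy_t := polyIntegral_div_mul _ _
  pearson := pearson_jacobiWeight A B t hα hβ hγ

end Weight
end

/-! ### The time derivative of the moments -/

open scoped Convolution

noncomputable section

section MomentDerivative

variable {α β γ : ℝ} (A B : ℝ) {t : ℝ} (hα : 0 < α) (hβ : 0 < β) (hγ : 0 < γ)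

/-- The kernel `|u|^γ (A + B θ(u)) / u` reflected and cut off to `[-1,1]`. -/
def cutKernel (γ A B u : ℝ) : ℝ :=
  indicator (Icc (-1) 1) (fun u => stepPow γ A B (-u) / (-u)) u

theorem cutKernel_sub {γ A B y s : ℝ} (hy : y ∈ Icc (0 : ℝ) 1) (hs : s ∈ Icc (0 : ℝ) 1) :
    cutKernel γ A B (s - y) = stepPow γ A B (y - s) / (y - s) := by
  rw [cutKernel, indicator_of_mem, neg_sub]
  exact ⟨by linarith [hy.2, hs.1], by linarith [hy.1, hs.2]⟩

include hγ in
theorem integrable_cutKernel : Integrable (cutKernel γ A B) := by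
  have h := (intervalIntegrable_stepPow_div A B hγ 1 (-1)).comp_sub_left 0
  simp only [zero_sub, neg_neg] at h
  rw [intervalIntegrable_iff_integrableOn_Icc_of_le (by norm_num)] at h
  exact (integrable_indicator_iff measurableSet_Icc).2 h

include hα hβ in
theorem integral_jacobiFactor_mul (q : ℝ[X]) (k : ℝ → ℝ) :
    ∫ y, q.eval y * jacobiFactor α β y * k y =
      ∫ y in (0 : ℝ)..1, q.eval y * jacobiFactor α β y * k y := by
  rw [intervalIntegral.integral_of_le zero_le_one]
  refine (setIntegral_eq_integral_of_forall_compl_eq_zero fun y hy => ?_).symm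
  rw [jacobiFactor_eq_zero hα hβ fun h => hy (Ioo_subset_Ioc_self h)]
  ring

theorem momentFun_eq_integral (q : ℝ[X]) (s : ℝ) : momentFun A B hα hβ hγ s q =
    ∫ y, q.eval y * jacobiFactor α β y * stepPow γ A B (y - s) := by
  rw [integral_jacobiFactor_mul hα hβ]
  refine intervalIntegral.integral_congr fun y hy => ?_
  rw [uIcc_of_le zero_le_one] at hy
  simp only [jacobiWeight_eq A B s hy]
  ring

theorem cauchyT_eq_integral (q : ℝ[X]) {s : ℝ} (hs : s ∈ Icc (0 : ℝ) 1) :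
    cauchyT A B hα hβ hγ s q =
      ∫ y, q.eval y * jacobiFactor α β y * cutKernel γ A B (s - y) := by
  rw [integral_jacobiFactor_mul hα hβ]
  refine intervalIntegral.integral_congr fun y hy => ?_
  rw [uIcc_of_le zero_le_one] at hy
  simp only [jacobiWeight_eq A B s hy, cutKernel_sub hy hs]
  ring

include hγ in
theorem integral_cutKernel_sub {y s : ℝ} (hy : y ∈ Ioo (0 : ℝ) 1) (hs : s ∈ Icc (0 : ℝ) 1)
    (ht : t ∈ Icc (0 : ℝ) 1) :
    γ * ∫ r in t..s, cutKernel γ A B (r - y) = stepPow γ A B (y - t) - stepPow γ A B (y - s) := by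
  have hsub : uIcc t s ⊆ Icc 0 1 := ordConnected_Icc.uIcc_subset ht hs
  have h1 : ∫ r in t..s, cutKernel γ A B (r - y) =
      ∫ r in t..s, stepPow γ A B (y - r) / (y - r) :=
    intervalIntegral.integral_congr fun r hr =>
      cutKernel_sub (Ioo_subset_Icc_self hy) (hsub hr)
  have h2 : IntervalIntegrable (fun r => γ * (stepPow γ A B (y - r) / (y - r))) volume t s := by
    have := (intervalIntegrable_stepPow_div A B hγ (y - t) (y - s)).comp_sub_left y
    simp only [sub_sub_cancel] at this
    exact this.const_mul γ
  have h3 := integral_eq_of_hasDerivAt_off_countable (a := t) (b := s)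
    (fun r => -stepPow γ A B (y - r)) _ (countable_singleton y)
    ((continuous_stepPow A B hγ).comp (continuous_const.sub continuous_id)).neg.continuousOn
    (fun r hr => ?_) h2
  · rw [h1, ← intervalIntegral.integral_const_mul, h3]
    ring
  · have hr' : y - r ≠ 0 := sub_ne_zero.2 (Ne.symm hr.2)
    have := ((hasDerivAt_stepPow (γ := γ) A B hr').comp_const_sub y r).neg
    rwa [neg_neg] at this

/-- For γ < 1 the kernel |y-s|^γ/(y-s) is unbounded and its singularity moves with s, so the
integrand is not differentiated directly. Instead its increment in s is written as an integral for
each y, Fubini exchanges the two integrals, and the fundamental theorem applies to the resulting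
continuous function `G`. -/
theorem hasDerivAt_momentFun (ht : t ∈ Ioo (0 : ℝ) 1) (q : ℝ[X]) :
    HasDerivAt (fun s => momentFun A B hα hβ hγ s q) (((-γ) • cauchyT A B hα hβ hγ t) q) t := by
  set ψ : ℝ → ℝ := fun y => q.eval y * jacobiFactor α β y with hψ
  set κ := cutKernel γ A B with hκ
  have hψc : Continuous ψ := q.continuous.mul (continuous_jacobiFactor hα hβ)
  have hψs : HasCompactSupport ψ := HasCompactSupport.intro (isCompact_Icc (a := 0) (b := 1))
    fun y hy => by
      simp only [hψ]
      rw [jacobiFactor_eq_zero hα hβ fun h => hy (Ioo_subset_Icc_self h), mul_zero]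
  have hκi : Integrable κ := integrable_cutKernel A B hγ
  set G : ℝ → ℝ := fun s => ∫ y, ψ y * κ (s - y) with hG
  -- `G` is the convolution of a continuous compactly supported function with an integrable one; the
  -- cutoff of the kernel makes the latter integrable on the whole line.
  have hGc : Continuous G :=
    hψs.continuous_convolution_left (ContinuousLinearMap.mul ℝ ℝ) hψc hκi.locallyIntegrable
  have hint : Integrable (fun p : ℝ × ℝ => ψ p.2 * κ (p.1 - p.2)) (volume.prod volume) :=
    (hψc.integrable_of_hasCompactSupport hψs).convolution_integrand
      (ContinuousLinearMap.mul ℝ ℝ) hκi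
  have hkey : ∀ s ∈ Ioo (0 : ℝ) 1, momentFun A B hα hβ hγ s q =
      momentFun A B hα hβ hγ t q - γ * ∫ r in t..s, G r := by
    intro s hs
    have hsw : ∫ r in t..s, G r = ∫ y, ∫ r in t..s, ψ y * κ (r - y) :=
      intervalIntegral_integral_swap
        (hint.mono_measure (Measure.prod_mono Measure.restrict_le_self le_rfl))
    have hi : ∀ s, Integrable fun y => ψ y * stepPow γ A B (y - s) := fun s =>
      (hψc.mul ((continuous_stepPow A B hγ).comp
        (continuous_id.sub continuous_const))).integrable_of_hasCompactSupport hψs.mul_right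
    have hp : ∀ y, γ * ∫ r in t..s, ψ y * κ (r - y) =
        ψ y * stepPow γ A B (y - t) - ψ y * stepPow γ A B (y - s) := by
      intro y
      rw [intervalIntegral.integral_const_mul]
      by_cases hy : y ∈ Ioo (0 : ℝ) 1
      · rw [mul_left_comm, hκ, integral_cutKernel_sub A B hγ hy (Ioo_subset_Icc_self hs)
          (Ioo_subset_Icc_self ht), mul_sub]
      · simp only [hψ]
        rw [jacobiFactor_eq_zero hα hβ hy]
        ring
    rw [hsw, ← integral_const_mul, momentFun_eq_integral, momentFun_eq_integral]
    simp_rw [hp]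
    rw [integral_sub (hi t) (hi s), sub_sub_cancel]
  have h1 : HasDerivAt (fun s => momentFun A B hα hβ hγ t q - γ * ∫ r in t..s, G r)
      (-(γ * G t)) t :=
    ((hGc.integral_hasStrictDerivAt t t).hasDerivAt.const_mul γ).const_sub _
  refine (h1.congr_of_eventuallyEq ?_).congr_deriv ?_
  · filter_upwards [Ioo_mem_nhds ht.1 ht.2] with s hs using hkey s hs
  · rw [LinearMap.smul_apply, cauchyT_eq_integral A B hα hβ hγ q (Ioo_subset_Icc_self ht),
      smul_eq_mul, neg_mul]

end MomentDerivative
end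

/-! ### Smoothness in t of moments, Cauchy functionals and polynomial families -/

noncomputable section

namespace IsSemiclassical

variable {α β γ t : ℝ} {μ L₀ L₁ Lt : ℝ[X] →ₗ[ℝ] ℝ}

/-- The test polynomial X-t cancels the pole at t, so the Pearson identity leaves L₁(1) as the only
value that is not a moment. -/
theorem cauchy_one_one (h : IsSemiclassical α β γ t μ L₀ L₁ Lt) :
    β * (1 - t) * L₁ 1 =
      -((2 + α + β + γ) * μ X + (β - t * (1 + α + β)) * μ 1) := by
  have h1 := h.pearson_X_mul (X - C t)
  have h2 : L₁ (X - C t) = L₁ ((X - C 1) * 1) + (1 - t) * L₁ 1 := by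
    rw [← smul_eq_mul (1 - t), ← map_smul, ← map_add, smul_eq_C_mul, C_sub]
    congr 1
    ring
  have h3 : Lt (X - C t) = μ 1 := by rw [← h.cauchy_t, mul_one]
  have h4 : μ (X - C t) = μ X - t * μ 1 := by
    rw [← smul_eq_mul t, ← map_smul, ← map_sub, smul_eq_C_mul, mul_one]
  rw [h2, h.cauchy_one, h3, h4, derivative_sub, derivative_X, derivative_C, sub_zero, mul_one] at h1
  linear_combination h1

/-- Here the test polynomial X-1 cancels the pole at 1 and isolates L_t(1). -/
theorem cauchy_t_one (h : IsSemiclassical α β γ t μ L₀ L₁ Lt) :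
    γ * (t * (t - 1)) * Lt 1 =
      -((2 + α + β + γ) * μ X + (γ * (t - 1) - 1 - α) * μ 1) := by
  have h1 := h.pearson_X_mul (X - C 1)
  have h2 : Lt (X - C 1) = Lt ((X - C t) * 1) + (t - 1) * Lt 1 := by
    rw [← smul_eq_mul (t - 1), ← map_smul, ← map_add, smul_eq_C_mul, C_sub]
    congr 1
    ring
  have h3 : L₁ (X - C 1) = μ 1 := by rw [← h.cauchy_one, mul_one]
  have h4 : μ (X - C 1) = μ X - μ 1 := by rw [C_1, map_sub]
  rw [h2, h.cauchy_t, h3, h4, derivative_sub, derivative_X, derivative_C, sub_zero, mul_one] at h1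
  linear_combination h1

end IsSemiclassical

section SmoothFamily

/-- The polynomials `P s` are of bounded degree and their coefficients are of class `C^m` on `U`. -/
structure IsSmoothFamily (m : ℕ) (U : Set ℝ) (P : ℝ → ℝ[X]) : Prop where
  bounded : ∃ N : ℕ, ∀ s, (P s).natDegree ≤ N
  coeff : ∀ k, ContDiffOn ℝ m (fun s => (P s).coeff k) U

variable {m : ℕ} {U : Set ℝ} {P Q : ℝ → ℝ[X]}

theorem isSmoothFamily_const (q : ℝ[X]) : IsSmoothFamily m U fun _ => q :=
  ⟨⟨q.natDegree, fun _ => le_rfl⟩, fun _ => contDiffOn_const⟩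

theorem IsSmoothFamily.mul (hP : IsSmoothFamily m U P) (hQ : IsSmoothFamily m U Q) :
    IsSmoothFamily m U fun s => P s * Q s := by
  obtain ⟨⟨N, hN⟩, hPc⟩ := hP
  obtain ⟨⟨M, hM⟩, hQc⟩ := hQ
  refine ⟨⟨N + M, fun s => natDegree_mul_le.trans (add_le_add (hN s) (hM s))⟩, fun k => ?_⟩
  simp only [coeff_mul]
  exact ContDiffOn.sum fun i _ => (hPc i.1).mul (hQc i.2)

theorem IsSmoothFamily.smul {f : ℝ → ℝ} (hf : ContDiffOn ℝ m f U) (hP : IsSmoothFamily m U P) :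
    IsSmoothFamily m U fun s => f s • P s := by
  obtain ⟨⟨N, hN⟩, hPc⟩ := hP
  refine ⟨⟨N, fun s => (natDegree_smul_le _ _).trans (hN s)⟩, fun k => ?_⟩
  simp only [coeff_smul, smul_eq_mul]
  exact hf.mul (hPc k)

theorem IsSmoothFamily.map (hP : IsSmoothFamily m U P) {Φ : ℝ → ℝ[X] →ₗ[ℝ] ℝ}
    (hΦ : ∀ q, ContDiffOn ℝ m (fun s => Φ s q) U) : ContDiffOn ℝ m (fun s => Φ s (P s)) U := by
  obtain ⟨⟨N, hN⟩, hPc⟩ := hP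
  simp_rw [fun s => map_eq_sum_range (Φ := Φ s) (hN s)]
  exact ContDiffOn.sum fun k _ => (hPc k).mul (hΦ _)

theorem IsSmoothFamily.exists_hasPolyDerivAt (hm : m ≠ 0) (hP : IsSmoothFamily m U P) {t : ℝ}
    (ht : U ∈ 𝓝 t) : ∃ P' : ℝ[X], HasPolyDerivAt P P' t := by
  obtain ⟨⟨N, hN⟩, hPc⟩ := hP
  have hd : ∀ k, HasDerivAt (fun s => (P s).coeff k) (deriv (fun s => (P s).coeff k) t) t :=
    fun k => (((hPc k).contDiffAt ht).differentiableAt (by exact_mod_cast hm)).hasDerivAt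
  refine ⟨∑ k ∈ Finset.range (N + 1), C (deriv (fun s => (P s).coeff k) t) * X ^ k,
    ⟨N, hN⟩, fun k => ?_⟩
  rw [finsetSum_coeff]
  simp only [coeff_C_mul_X_pow]
  rw [Finset.sum_ite_eq]
  split_ifs with hk
  · exact hd k
  · have : (fun s => (P s).coeff k) = fun _ => 0 := funext fun s =>
      coeff_eq_zero_of_natDegree_lt ((hN s).trans_lt (by simpa using hk))
    rw [this]
    exact hasDerivAt_const t 0

end SmoothFamily

section Moments

variable {α β γ : ℝ} (A B : ℝ) {t : ℝ} (hα : 0 < α) (hβ : 0 < β) (hγ : 0 < γ)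

theorem cauchyT_one_eq {s : ℝ} (hs : s ∈ Ioo (0 : ℝ) 1) : cauchyT A B hα hβ hγ s 1 =
    -((2 + α + β + γ) * momentFun A B hα hβ hγ s X +
      (γ * (s - 1) - 1 - α) * momentFun A B hα hβ hγ s 1) / (γ * (s * (s - 1))) := by
  have h1 : γ * (s * (s - 1)) ≠ 0 :=
    mul_ne_zero hγ.ne' (mul_ne_zero hs.1.ne' (sub_neg.2 hs.2).ne)
  rw [← (isSemiclassical_jacobiWeight A B s hα hβ hγ).cauchy_t_one, mul_div_cancel_left₀ _ h1]

theorem cauchyOne_one_eq {s : ℝ} (hs : s ∈ Ioo (0 : ℝ) 1) : cauchyOne A B hα hβ hγ s 1 =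
    -((2 + α + β + γ) * momentFun A B hα hβ hγ s X +
      (β - s * (1 + α + β)) * momentFun A B hα hβ hγ s 1) / (β * (1 - s)) := by
  have h1 : β * (1 - s) ≠ 0 := mul_ne_zero hβ.ne' (sub_pos.2 hs.2).ne'
  rw [← (isSemiclassical_jacobiWeight A B s hα hβ hγ).cauchy_one_one, mul_div_cancel_left₀ _ h1]

/-- The recursion L(X^(k+1)) = μ(X^k) + a L(X^k) reduces everything to L(1). -/
theorem contDiffOn_cauchy {m : ℕ} {U : Set ℝ} {μ L : ℝ → ℝ[X] →ₗ[ℝ] ℝ} {a : ℝ → ℝ}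
    (hL : ∀ s q, L s ((X - C (a s)) * q) = μ s q) (ha : ContDiffOn ℝ m a U)
    (hμ : ∀ q, ContDiffOn ℝ m (fun s => μ s q) U) (h1 : ContDiffOn ℝ m (fun s => L s 1) U)
    (q : ℝ[X]) : ContDiffOn ℝ m (fun s => L s q) U := by
  have hX : ∀ k, ContDiffOn ℝ m (fun s => L s (X ^ k)) U := by
    intro k
    induction k with
    | zero => simpa using h1
    | succ k ih =>
      simp_rw [pow_succ', fun s => cauchy_X_mul (hL s) (X ^ k)]
      exact (hμ _).add (ha.mul ih)
  simp_rw [fun s => map_eq_sum_range (Φ := L s) (le_refl q.natDegree)]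
  exact ContDiffOn.sum fun k _ => contDiffOn_const.mul (hX k)

theorem contDiffOn_cauchyT {m : ℕ}
    (hμ : ∀ q, ContDiffOn ℝ m (fun s => momentFun A B hα hβ hγ s q) (Ioo 0 1)) (q : ℝ[X]) :
    ContDiffOn ℝ m (fun s => cauchyT A B hα hβ hγ s q) (Ioo 0 1) := by
  refine contDiffOn_cauchy (fun s => (isSemiclassical_jacobiWeight A B s hα hβ hγ).cauchy_t)
    contDiffOn_id hμ ?_ q
  refine ContDiffOn.congr ?_ fun s hs => cauchyT_one_eq A B hα hβ hγ hs
  refine ContDiffOn.div ?_ ?_ fun s hs =>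
    mul_ne_zero hγ.ne' (mul_ne_zero hs.1.ne' (sub_neg.2 hs.2).ne)
  · exact ((contDiffOn_const.mul (hμ _)).add ((by fun_prop : ContDiff ℝ m
      fun s : ℝ => γ * (s - 1) - 1 - α).contDiffOn.mul (hμ _))).neg
  · fun_prop

/-- Bootstrap: if all moments are C^m, so is L_t by the formula for L_t(1), and L_t is up to a
constant the derivative of the moments. -/
theorem contDiffOn_momentFun (m : ℕ) (q : ℝ[X]) :
    ContDiffOn ℝ m (fun s => momentFun A B hα hβ hγ s q) (Ioo 0 1) := by
  induction m generalizing q with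
  | zero =>
    exact contDiffOn_zero.2 fun s hs =>
      (hasDerivAt_momentFun A B hα hβ hγ hs q).continuousAt.continuousWithinAt
  | succ m ih =>
    push_cast
    rw [contDiffOn_succ_iff_deriv_of_isOpen isOpen_Ioo]
    refine ⟨fun s hs => (hasDerivAt_momentFun A B hα hβ hγ
      hs q).differentiableAt.differentiableWithinAt, by simp, ?_⟩
    refine ContDiffOn.congr ?_ fun s hs => (hasDerivAt_momentFun A B hα hβ hγ hs q).deriv
    exact contDiffOn_const.mul (contDiffOn_cauchyT A B hα hβ hγ ih q)

theorem contDiffOn_cauchyOne (m : ℕ) (q : ℝ[X]) :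
    ContDiffOn ℝ m (fun s => cauchyOne A B hα hβ hγ s q) (Ioo 0 1) := by
  have hμ := contDiffOn_momentFun A B hα hβ hγ m
  refine contDiffOn_cauchy (a := fun _ => 1)
    (fun s => (isSemiclassical_jacobiWeight A B s hα hβ hγ).cauchy_one) contDiffOn_const hμ ?_ q
  refine ContDiffOn.congr ?_ fun s hs => cauchyOne_one_eq A B hα hβ hγ hs
  refine ContDiffOn.div ?_ ?_ fun s hs => mul_ne_zero hβ.ne' (sub_pos.2 hs.2).ne'
  · exact ((contDiffOn_const.mul (hμ _)).add ((by fun_prop : ContDiff ℝ m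
      fun s : ℝ => β - s * (1 + α + β)).contDiffOn.mul (hμ _))).neg
  · fun_prop

theorem hasDerivAt_cauchyOne_one (ht : t ∈ Ioo (0 : ℝ) 1) :
    HasDerivAt (fun s => cauchyOne A B hα hβ hγ s 1)
      (-γ / (1 - t) * (cauchyOne A B hα hβ hγ t 1 - cauchyT A B hα hβ hγ t 1)) t := by
  have h := isSemiclassical_jacobiWeight A B t hα hβ hγ
  have h1t : 1 - t ≠ 0 := (sub_pos.2 ht.2).ne'
  have d0 := hasDerivAt_momentFun A B hα hβ hγ ht 1
  have d1 := hasDerivAt_momentFun A B hα hβ hγ ht X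
  have e0 := h.cauchy_one_one
  have e1 := h.pearson_X_mul 1
  have e2 := cauchy_X_mul h.cauchy_t 1
  rw [mul_one] at e2
  rw [LinearMap.smul_apply, smul_eq_mul] at d0 d1
  rw [e2] at d1
  simp only [derivative_one, mul_zero, map_zero, zero_add] at e1
  have dl : HasDerivAt (fun s : ℝ => β - s * (1 + α + β)) (-(1 * (1 + α + β))) t :=
    ((hasDerivAt_id t).mul_const _).const_sub _
  have dd : HasDerivAt (fun s : ℝ => β * (1 - s)) (β * -1) t :=
    ((hasDerivAt_id t).const_sub 1).const_mul β
  have d := ((d1.const_mul (2 + α + β + γ)).add (dl.mul d0)).neg.div dd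
    (mul_ne_zero hβ.ne' h1t)
  refine (d.congr_of_eventuallyEq ?_).congr_deriv ?_
  · filter_upwards [Ioo_mem_nhds ht.1 ht.2] with s hs using cauchyOne_one_eq A B hα hβ hγ hs
  · simp only [Pi.add_apply, Pi.mul_apply, Pi.neg_apply]
    rw [← e0]
    field_simp
    linear_combination (1 + γ) * e1

/-- Formally this is the partial fraction expansion of 1/((x-1)(x-t)). To avoid another singular
integral, q is divided by X-1: the quotient contributes a moment, and the remainder a multiple of
L₁(1), whose closed form has already been differentiated. -/
theorem hasDerivAt_cauchyOne (ht : t ∈ Ioo (0 : ℝ) 1) (q : ℝ[X]) :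
    HasDerivAt (fun s => cauchyOne A B hα hβ hγ s q)
      (((-γ / (1 - t)) • (cauchyOne A B hα hβ hγ t - cauchyT A B hα hβ hγ t)) q) t := by
  have h := fun s => isSemiclassical_jacobiWeight A B s hα hβ hγ
  have h1t : 1 - t ≠ 0 := (sub_pos.2 ht.2).ne'
  obtain ⟨r, hr, -⟩ := exists_eq_X_sub_C_mul_add 1 q
  have hq : ∀ s, cauchyOne A B hα hβ hγ s q = momentFun A B hα hβ hγ s r +
      q.eval 1 * cauchyOne A B hα hβ hγ s 1 := by
    intro s
    rw [← (h s).cauchy_one, ← smul_eq_mul (q.eval 1), ← map_smul, ← map_add, smul_eq_C_mul,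
      mul_one, ← hr]
  have hqt : cauchyT A B hα hβ hγ t q = momentFun A B hα hβ hγ t r
      - (1 - t) * cauchyT A B hα hβ hγ t r + q.eval 1 * cauchyT A B hα hβ hγ t 1 := by
    rw [← (h t).cauchy_t, ← smul_eq_mul (1 - t), ← smul_eq_mul (q.eval 1), ← map_smul,
      ← map_smul, ← map_sub,
      ← map_add, smul_eq_C_mul, smul_eq_C_mul, mul_one]
    conv_lhs => rw [hr]
    congr 1
    rw [C_sub]
    ring
  simp_rw [hq]
  refine ((hasDerivAt_momentFun A B hα hβ hγ ht r).add
    ((hasDerivAt_cauchyOne_one A B hα hβ hγ ht).const_mul (q.eval 1))).congr_deriv ?_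
  simp only [LinearMap.smul_apply, LinearMap.sub_apply, smul_eq_mul, hq, hqt]
  field_simp
  ring

end Moments
end

/-! ### Elimination leading to Painlevé VI -/

-- Here F and F' stand for S' and S''. The a_i are functions of S and t, and the primed quantities
-- come from the Schlesinger equations with each D_i replaced by b_i(b_i - ·)/a_i. What remains is a
-- rational identity in S, t, b₁, b₂, valid modulo the single quadratic relation `hE`.
set_option maxRecDepth 10000 in
set_option maxHeartbeats 1000000 in
theorem painleveVI_algebra {α β γ n c t S b0 b1 b2 a0 a1 a2 a1' a2' b1' b2' F F' : ℝ}
    (hc : c = 2 * n + α + β + γ + 1) (hc0 : c ≠ 0) (ht0 : t ≠ 0) (ht1 : t - 1 ≠ 0)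
    (hS0 : S ≠ 0) (hS1 : S - 1 ≠ 0) (hSt : S - t ≠ 0)
    (ha0 : a0 = c * S / t) (ha1 : a1 = -(c * (S - 1) / (t - 1)))
    (ha2 : a2 = c * (S - t) / (t * (t - 1)))
    (hb0 : b0 = -n - b1 - b2)
    (hE : b0 * (b0 - α) / a0 + b1 * (b1 - β) / a1 + b2 * (b2 - γ) / a2 = 0)
    (ha1' : a1' = (2 * (a2 * b1 - b2 * a1) + γ * a1 - β * a2) / (t - 1) + a2 * a1)
    (ha2' : a2' = (-a2 - a1') / t)
    (hb1' : b1' = (a2 * (b1 * (b1 - β) / a1) - b2 * (b2 - γ) / a2 * a1) / (t - 1))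
    (hb2' : b2' = -b1' / t)
    (hF : c * F = -a1 - (t - 1) * a1')
    (hF' : c * F' = -a1' + (2 * (b2' * a1 + b2 * a1' - (a2' * b1 + a2 * b1')) - γ * a1' + β * a2'
       - a2 * a1 + (1 - t) * (a2' * a1 + a2 * a1'))) :
    F' = 1 / 2 * (1 / S + 1 / (S - 1) + 1 / (S - t)) * F ^ 2
      - (1 / t + 1 / (t - 1) + 1 / (S - t)) * F
      + S * (S - 1) * (S - t) / (t ^ 2 * (t - 1) ^ 2) *
        (c ^ 2 / 2 + -α ^ 2 / 2 * t / S ^ 2 + β ^ 2 / 2 * (t - 1) / (S - 1) ^ 2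
          + (1 - γ ^ 2) / 2 * t * (t - 1) / (S - t) ^ 2) := by
  have hF2 : F = (-a1 - (t - 1) * a1') / c := by field_simp; linarith
  have hF2' : F' = (-a1' + (2 * (b2' * a1 + b2 * a1' - (a2' * b1 + a2 * b1')) - γ * a1' + β * a2'
       - a2 * a1 + (1 - t) * (a2' * a1 + a2 * a1'))) / c := by field_simp; linarith
  have hn : n = (c - 1 - α - β - γ) / 2 := by linarith
  -- With this factor, the left side of `hE` equals exactly the difference of the two sides of
  -- Painlevé VI, so the final step is a pure ring identity.
  have hE' : 2 / (c * t) * (a1 * a2) * (b0 * (b0 - α) / a0 + b1 * (b1 - β) / a1 +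
    b2 * (b2 - γ) / a2) = 0 := by rw [hE, mul_zero]
  clear hE hF hF'
  rw [hF2, hF2', hb2', hb1', ha2', ha1']
  clear hF2 hF2' hb2' hb1' ha2' ha1'
  rw [ha0, ha1, ha2] at *
  rw [hb0, hn] at hE'
  rw [← sub_eq_zero, ← hE']
  clear hE'
  field_simp
  ring

/-! ### Positivity and the Gram-Schmidt polynomials -/

noncomputable section

section Positivity

variable {α β γ A B t : ℝ}

theorem jacobiWeight_nonneg (hA : 0 ≤ A) (hAB : 0 ≤ A + B) {x : ℝ} (hx : x ∈ Icc (0 : ℝ) 1) :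
    0 ≤ jacobiWeight α β γ A B t x := by
  refine mul_nonneg (mul_nonneg (mul_nonneg (Real.rpow_nonneg hx.1 _)
    (Real.rpow_nonneg (sub_nonneg.2 hx.2) _)) (Real.rpow_nonneg (abs_nonneg _) _)) ?_
  unfold stepFn
  split_ifs
  · simpa using hAB
  · simpa using hA

theorem jacobiWeight_ne_zero {x : ℝ} (hx : x ∈ Ioo (0 : ℝ) 1) (hxt : x ≠ t)
    (h : A + B * stepFn (x - t) ≠ 0) : jacobiWeight α β γ A B t x ≠ 0 :=
  mul_ne_zero (mul_pos (mul_pos (Real.rpow_pos_of_pos hx.1 _)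
    (Real.rpow_pos_of_pos (sub_pos.2 hx.2) _))
    (Real.rpow_pos_of_pos (abs_pos.2 (sub_ne_zero.2 hxt)) _)).ne' h

theorem exists_Ioo_jacobiWeight_ne_zero (hne : ¬(A = 0 ∧ B = 0)) (ht : t ∈ Ioo (0 : ℝ) 1) :
    ∃ a b : ℝ, 0 ≤ a ∧ a < b ∧ b ≤ 1 ∧ ∀ x ∈ Ioo a b, jacobiWeight α β γ A B t x ≠ 0 := by
  by_cases hA0 : A = 0
  · refine ⟨t, 1, ht.1.le, ht.2, le_rfl, fun x hx =>
      jacobiWeight_ne_zero ⟨ht.1.trans hx.1, hx.2⟩ hx.1.ne' ?_⟩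
    have hB0 : B ≠ 0 := fun h => hne ⟨hA0, h⟩
    simpa [stepFn, hA0, hx.1] using hB0
  · refine ⟨0, t, le_rfl, ht.1, ht.2.le, fun x hx =>
      jacobiWeight_ne_zero ⟨hx.1, hx.2.trans ht.2⟩ hx.2.ne ?_⟩
    simpa [stepFn, not_lt.2 hx.2.le] using hA0

/-- A weight which is a positive multiple of the Jacobi weight gives a positive definite form. -/
theorem weightForm_self_pos_of_jacobiWeight (hA : 0 ≤ A) (hAB : 0 ≤ A + B)
    (hne : ¬(A = 0 ∧ B = 0)) (ht : t ∈ Ioo (0 : ℝ) 1) {k g : ℝ → ℝ}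
    (hg : ∀ x, g x = jacobiWeight α β γ A B t x * k x) (hgi : IntervalIntegrable g volume 0 1)
    (hk : ∀ x ∈ Ioc (0 : ℝ) 1, 0 ≤ k x) (hk' : ∀ x ∈ Ioo (0 : ℝ) 1, k x ≠ 0) {p : ℝ[X]}
    (hp : p ≠ 0) : 0 < weightForm g p p := by
  obtain ⟨a, b, ha, hab, hb, h⟩ := exists_Ioo_jacobiWeight_ne_zero (α := α) (β := β) (γ := γ) hne ht
  refine weightForm_self_pos hgi (fun x hx => ?_) ha hab hb (fun x hx => ?_) hp
  · rw [hg]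
    exact mul_nonneg (jacobiWeight_nonneg hA hAB (Ioc_subset_Icc_self hx)) (hk x hx)
  · rw [hg]
    exact mul_ne_zero (h x hx) (hk' x ⟨ha.trans_lt hx.1, hx.2.trans_le hb⟩)

theorem polyIntegral_mul {g : ℝ → ℝ} (hg : IntervalIntegrable g volume 0 1) (p q : ℝ[X]) :
    polyIntegral g hg (p * q) = weightForm g p q := by
  simp only [polyIntegral, weightForm, LinearMap.coe_mk, AddHom.coe_mk, eval_mul]

variable (hα : 0 < α) (hβ : 0 < β) (hγ : 0 < γ) (hA : 0 ≤ A) (hAB : 0 ≤ A + B)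
  (hne : ¬(A = 0 ∧ B = 0)) (ht : t ∈ Ioo (0 : ℝ) 1) {p : ℝ[X]} (hp : p ≠ 0)
include hA hAB hne ht hp

theorem momentFun_mul_self_pos : 0 < momentFun A B hα hβ hγ t (p * p) := by
  rw [momentFun, polyIntegral_mul]
  exact weightForm_self_pos_of_jacobiWeight hA hAB hne ht (k := fun _ => 1)
    (fun x => (mul_one _).symm) (jacobiWeight_intervalIntegrable A B t hα hβ hγ)
    (fun _ _ => zero_le_one) (fun _ _ => one_ne_zero) hp

theorem cauchyZero_mul_self_pos : 0 < cauchyZero A B hα hβ hγ t (p * p) := by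
  rw [cauchyZero, polyIntegral_mul]
  exact weightForm_self_pos_of_jacobiWeight hA hAB hne ht (k := fun x => (x - 0)⁻¹)
    (fun x => div_eq_mul_inv _ _) (intervalIntegrable_jacobiWeight_div_zero A B t hα hβ hγ)
    (fun x hx => by rw [sub_zero]; exact inv_nonneg.2 hx.1.le)
    (fun x hx => by rw [sub_zero]; exact inv_ne_zero hx.1.ne') hp

/-- The factor 1/(x-1) has constant sign on (0,1), as 1/x does. The factor 1/(x-t) changes sign,
which is why S = t is not excluded by the same argument as S = 0 and S = 1. -/
theorem cauchyOne_mul_self_neg : cauchyOne A B hα hβ hγ t (p * p) < 0 := by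
  have h := weightForm_self_pos_of_jacobiWeight (α := α) (β := β) (γ := γ) hA hAB hne ht
    (k := fun x => -(x - 1)⁻¹)
    (fun x => rfl) ((intervalIntegrable_jacobiWeight_div_one A B t hα hβ hγ).neg.congr
      fun x _ => by simp only [Pi.neg_apply]; rw [mul_neg, div_eq_mul_inv])
    (fun x hx => by
      rw [neg_nonneg]
      exact inv_nonpos.2 (sub_nonpos.2 hx.2))
    (fun x hx => neg_ne_zero.2 (inv_ne_zero (sub_neg.2 hx.2).ne)) hp
  rw [← neg_pos, cauchyOne, polyIntegral_mul]
  refine h.trans_eq ?_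
  unfold weightForm
  rw [← intervalIntegral.integral_neg]
  congr 1
  funext x
  ring

end Positivity

theorem degree_sub_coeff_smul_lt {p q : ℝ[X]} {m : ℕ} (hp : p.Monic) (hdeg : p.natDegree = m)
    (hq : q.degree < (m + 1 : ℕ)) : (q - q.coeff m • p).degree < (m : WithBot ℕ) := by
  rw [degree_lt_iff_coeff_zero]
  intro k hk
  rw [coeff_sub, coeff_smul, smul_eq_mul]
  rcases hk.eq_or_lt with rfl | hk
  · rw [show p.coeff m = 1 from hdeg ▸ hp.coeff_natDegree]
    ring
  · rw [coeff_eq_zero_of_degree_lt (hq.trans_le (by exact_mod_cast hk)),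
      coeff_eq_zero_of_natDegree_lt (hdeg.trans_lt hk)]
    ring

/-- The polynomial `P_{n-1} / h_{n-1}` (zero for `n = 0`). -/
def dualOP (w : ℝ → ℝ) : ℕ → ℝ[X]
  | 0 => 0
  | n + 1 => (weightForm w (monicOP w n) (monicOP w n))⁻¹ • monicOP w n

/-- Pairwise orthogonality extends to all polynomials of lower degree by successively removing the
top coefficient with the monic polynomial of that degree. -/
theorem map_monicOP_mul {w : ℝ → ℝ} {μ : ℝ[X] →ₗ[ℝ] ℝ} (hμ : ∀ p q, μ (p * q) = weightForm w p q)
    (hw : IntervalIntegrable w volume 0 1)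
    (h0 : ∀ n, weightForm w (monicOP w n) (monicOP w n) ≠ 0) (n m : ℕ) (hm : m ≤ n) (q : ℝ[X])
    (hq : q.degree < m) : μ (monicOP w n * q) = 0 := by
  induction m generalizing q with
  | zero =>
    rw [Nat.cast_zero, ← not_le, zero_le_degree_iff, not_not] at hq
    rw [hq, mul_zero, map_zero]
  | succ m ih =>
    obtain ⟨hmonic, hdeg⟩ := monicOP_monic_natDegree w m
    have h1 := degree_sub_coeff_smul_lt hmonic hdeg hq
    have h2 := ih (by omega) _ h1
    rw [mul_sub, map_sub, mul_smul_comm, map_smul, hμ _ (monicOP w m),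
      weightForm_monicOP_eq_zero hw h0 hm, smul_zero, sub_zero] at h2
    exact h2

theorem isDualPair_monicOP {w : ℝ → ℝ} {μ : ℝ[X] →ₗ[ℝ] ℝ}
    (hμ : ∀ p q, μ (p * q) = weightForm w p q) (hw : IntervalIntegrable w volume 0 1)
    (h0 : ∀ n, weightForm w (monicOP w n) (monicOP w n) ≠ 0) (n : ℕ) :
    IsDualPair μ n (monicOP w n) (dualOP w n) where
  monic := (monicOP_monic_natDegree w n).1
  natDegree_eq := (monicOP_monic_natDegree w n).2
  orthogonal := map_monicOP_mul hμ hw h0 n n le_rfl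
  degree_lt := by
    cases n with
    | zero => rw [dualOP, degree_zero]; exact WithBot.bot_lt_coe 0
    | succ n =>
      refine (degree_smul_le _ _).trans_lt (degree_le_natDegree.trans_lt ?_)
      rw [(monicOP_monic_natDegree w n).2]
      exact_mod_cast Nat.lt_succ_self n
  dual := by
    intro q hq
    cases n with
    | zero =>
      rw [Nat.cast_zero, ← not_le, zero_le_degree_iff, not_not] at hq
      simp [hq]
    | succ n =>
      obtain ⟨hmonic, hdeg⟩ := monicOP_monic_natDegree w n
      have h1 := degree_sub_coeff_smul_lt hmonic hdeg hq
      have h2 := map_monicOP_mul hμ hw h0 n n le_rfl _ h1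
      rw [mul_sub, map_sub, mul_smul_comm, map_smul, hμ _ (monicOP w n), sub_eq_zero] at h2
      rw [dualOP, smul_mul_assoc, map_smul, h2, smul_eq_mul, smul_eq_mul, Nat.add_sub_cancel]
      field_simp [h0 n]

theorem momentFun_mul {α β γ : ℝ} (A B : ℝ) (hα : 0 < α) (hβ : 0 < β) (hγ : 0 < γ) (t : ℝ)
    (p q : ℝ[X]) :
    momentFun A B hα hβ hγ t (p * q) = weightForm (jacobiWeight α β γ A B t) p q :=
  polyIntegral_mul _ p q

section SmoothOP

variable {α β γ A B : ℝ} (hα : 0 < α) (hβ : 0 < β) (hγ : 0 < γ) (hA : 0 ≤ A) (hAB : 0 ≤ A + B)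
  (hne : ¬(A = 0 ∧ B = 0))
include hα hβ hγ hA hAB hne

theorem isDualPair_jacobiWeight (n : ℕ) {t : ℝ} (ht : t ∈ Ioo (0 : ℝ) 1) :
    IsDualPair (momentFun A B hα hβ hγ t) n (monicOP (jacobiWeight α β γ A B t) n)
      (dualOP (jacobiWeight α β γ A B t) n) := by
  refine isDualPair_monicOP (momentFun_mul A B hα hβ hγ t)
    (jacobiWeight_intervalIntegrable A B t hα hβ hγ)
    (fun m => ?_) n
  rw [← momentFun_mul A B hα hβ hγ]
  exact (momentFun_mul_self_pos hα hβ hγ hA hAB hne ht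
    (monicOP_monic_natDegree _ m).1.ne_zero).ne'

/-- The Gram-Schmidt coefficients are quotients of smooth pairings, and positive definiteness keeps
the denominators away from zero. -/
theorem isSmoothFamily_monicOP (m n : ℕ) :
    IsSmoothFamily m (Ioo 0 1) fun t => monicOP (jacobiWeight α β γ A B t) n := by
  induction n using Nat.strong_induction_on with
  | _ n ih =>
    refine ⟨⟨n, fun t => (monicOP_monic_natDegree _ n).2.le⟩, fun k => ?_⟩
    simp_rw [fun t => monicOP.eq_1 (jacobiWeight α β γ A B t) n]
    simp only [coeff_sub, finsetSum_coeff, coeff_C_mul]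
    refine contDiffOn_const.sub (ContDiffOn.sum fun i _ => ?_)
    have hi := ih i i.isLt
    simp_rw [← momentFun_mul A B hα hβ hγ]
    refine ContDiffOn.mul (ContDiffOn.div ?_ ?_ fun t ht => ?_) (hi.coeff k)
    · exact ((isSmoothFamily_const (X ^ n)).mul hi).map (contDiffOn_momentFun A B hα hβ hγ m)
    · exact (hi.mul hi).map (contDiffOn_momentFun A B hα hβ hγ m)
    · exact (momentFun_mul_self_pos hα hβ hγ hA hAB hne ht
        (monicOP_monic_natDegree _ i).1.ne_zero).ne'

theorem isSmoothFamily_dualOP (m n : ℕ) :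
    IsSmoothFamily m (Ioo 0 1) fun t => dualOP (jacobiWeight α β γ A B t) n := by
  cases n with
  | zero => exact isSmoothFamily_const 0
  | succ n =>
    have hn := isSmoothFamily_monicOP hα hβ hγ hA hAB hne m n
    refine IsSmoothFamily.smul (ContDiffOn.inv ?_ fun t ht => ?_) hn
    · simp_rw [← momentFun_mul A B hα hβ hγ]
      exact (hn.mul hn).map (contDiffOn_momentFun A B hα hβ hγ m)
    · rw [← momentFun_mul A B hα hβ hγ]
      exact (momentFun_mul_self_pos hα hβ hγ hA hAB hne ht
        (monicOP_monic_natDegree _ n).1.ne_zero).ne'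

end SmoothOP
end

/-! ### From the Schlesinger system to the properties of S -/

section System

/-- The residues of the Lax matrix of the sixth Painlevé equation, as functions of `t`, subject to
the Schlesinger equations. -/
structure IsSchlesingerSystem (α β γ n c : ℝ) (a₁ a₂ b₁ b₂ D₁ D₂ : ℝ → ℝ) : Prop where
  sum_X : ∀ s ∈ Ioo (0 : ℝ) 1, c + a₁ s + s * a₂ s = 0
  neg_one : ∀ s ∈ Ioo (0 : ℝ) 1, a₁ s < 0
  pos_zero : ∀ s ∈ Ioo (0 : ℝ) 1, 0 < -a₁ s - a₂ s
  det_one : ∀ s ∈ Ioo (0 : ℝ) 1, a₁ s * D₁ s = b₁ s * (b₁ s - β)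
  det_t : ∀ s ∈ Ioo (0 : ℝ) 1, a₂ s * D₂ s = b₂ s * (b₂ s - γ)
  det_zero : ∀ s ∈ Ioo (0 : ℝ) 1,
    (-a₁ s - a₂ s) * (-D₁ s - D₂ s) = (-n - b₁ s - b₂ s) * ((-n - b₁ s - b₂ s) - α)
  hasDerivAt_a₁ : ∀ s ∈ Ioo (0 : ℝ) 1, HasDerivAt a₁
    ((2 * (a₂ s * b₁ s - b₂ s * a₁ s) + γ * a₁ s - β * a₂ s) / (s - 1) + a₂ s * a₁ s) s
  hasDerivAt_b₁ : ∀ s ∈ Ioo (0 : ℝ) 1,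
    HasDerivAt b₁ ((a₂ s * D₁ s - D₂ s * a₁ s) / (s - 1)) s
  hasDerivAt_sum : ∀ s ∈ Ioo (0 : ℝ) 1, HasDerivAt (fun r => b₁ r + r * b₂ r) (b₂ s) s

namespace IsSchlesingerSystem

variable {α β γ n c : ℝ} {a₁ a₂ b₁ b₂ D₁ D₂ S : ℝ → ℝ} {t : ℝ}
  (h : IsSchlesingerSystem α β γ n c a₁ a₂ b₁ b₂ D₁ D₂) (ht : t ∈ Ioo (0 : ℝ) 1)
include h ht

theorem hasDerivAt_a₂ {a₁' : ℝ} (ha : HasDerivAt a₁ a₁' t) :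
    HasDerivAt a₂ ((-a₂ t - a₁') / t) t := by
  have ht0 : t ≠ 0 := ht.1.ne'
  have h1 := (ha.const_sub (-c)).div (hasDerivAt_id t) ht0
  refine (h1.congr_of_eventuallyEq ?_).congr_deriv ?_
  · filter_upwards [Ioo_mem_nhds ht.1 ht.2] with s hs
    have h2 := h.sum_X s hs
    have hs0 : s ≠ 0 := hs.1.ne'
    simp only [Pi.div_apply, id]
    rw [eq_div_iff hs0]
    linarith
  · have h2 := h.sum_X t ht
    have h3 : a₁ t = -c - t * a₂ t := by linarith
    simp only [id, h3]
    field_simp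
    ring

theorem hasDerivAt_b₂ {b₁' : ℝ} (hb : HasDerivAt b₁ b₁' t) :
    HasDerivAt b₂ (-b₁' / t) t := by
  have ht0 : t ≠ 0 := ht.1.ne'
  have h1 := ((h.hasDerivAt_sum t ht).sub hb).div (hasDerivAt_id t) ht0
  refine (h1.congr_of_eventuallyEq ?_).congr_deriv ?_
  · filter_upwards [lt_mem_nhds ht.1] with s hs
    have hs0 : s ≠ 0 := hs.ne'
    simp only [Pi.div_apply, Pi.sub_apply, id]
    field_simp
    ring
  · simp only [Pi.sub_apply, id]
    field_simp
    ring

variable (hc : 0 < c) (hS : ∀ s ∈ Ioo (0 : ℝ) 1, S s = 1 - (s - 1) * a₁ s / c)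
include hc hS

/-- The relations between the residues give S = t a₀/c with a₀ = -a₁-a₂ > 0. -/
theorem pos : 0 < S t := by
  have h1 := h.sum_X t ht
  have h2 := mul_pos ht.1 (h.pos_zero t ht)
  rw [hS t ht, sub_pos, div_lt_one hc]
  linarith

theorem lt_one : S t < 1 := by
  rw [hS t ht, sub_lt_self_iff]
  exact div_pos (mul_pos_of_neg_of_neg (sub_neg.2 ht.2) (h.neg_one t ht)) hc

theorem hasDerivAt : HasDerivAt S ((-a₁ t + 2 * (b₂ t * a₁ t - a₂ t * b₁ t) - γ * a₁ t + β * a₂ t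
    + (1 - t) * (a₂ t * a₁ t)) / c) t := by
  have h1 := (((hasDerivAt_id t).sub_const 1).mul (h.hasDerivAt_a₁ t ht)).div_const c
  have ht1 : t - 1 ≠ 0 := (sub_neg.2 ht.2).ne
  refine ((h1.const_sub 1).congr_of_eventuallyEq ?_).congr_deriv ?_
  · filter_upwards [Ioo_mem_nhds ht.1 ht.2] with s hs using hS s hs
  · simp only [id]
    field_simp
    ring

theorem a₂_eq : a₂ t = c * (S t - t) / (t * (t - 1)) := by
  have h1 := h.sum_X t ht
  have ht0 : t ≠ 0 := ht.1.ne'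
  have ht1 : t - 1 ≠ 0 := (sub_neg.2 ht.2).ne
  rw [hS t ht]
  field_simp
  linear_combination (t - 1) * h1

omit h in
theorem a₁_eq : a₁ t = -(c * (S t - 1) / (t - 1)) := by
  have ht1 : t - 1 ≠ 0 := (sub_neg.2 ht.2).ne
  rw [hS t ht]
  field_simp
  ring

/-- A zero of S(s) - s is simple: there a₂ = 0, the rank-one condition forces b₂ to be 0 or γ, and
the derivative γ - 2b₂ is ±γ. Away from zeros, continuity suffices. -/
theorem eventually_ne (hγ : γ ≠ 0) : ∀ᶠ s in 𝓝[≠] t, S s ≠ s := by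
  have hd := (h.hasDerivAt ht hc hS).sub (hasDerivAt_id t)
  have ha₂ := h.a₂_eq ht hc hS
  by_cases hSt : S t = t
  · rw [hSt, sub_self, mul_zero, zero_div] at ha₂
    have h1 := h.sum_X t ht
    have h2 := h.det_t t ht
    rw [ha₂, mul_zero, add_zero] at h1
    rw [ha₂, zero_mul] at h2
    have ha₁ : a₁ t = -c := by linarith
    have hne : (-a₁ t + 2 * (b₂ t * a₁ t - a₂ t * b₁ t) - γ * a₁ t + β * a₂ t
        + (1 - t) * (a₂ t * a₁ t)) / c - 1 ≠ 0 := by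
      have h3 : (-a₁ t + 2 * (b₂ t * a₁ t - a₂ t * b₁ t) - γ * a₁ t + β * a₂ t
        + (1 - t) * (a₂ t * a₁ t)) / c - 1 = γ - 2 * b₂ t := by
        rw [ha₁, ha₂]
        field_simp
        ring
      rw [h3]
      rcases mul_eq_zero.1 h2.symm with hb | hb
      · simpa [hb] using hγ
      · intro h4
        exact hγ (by linarith)
    filter_upwards [hd.eventually_ne (c := 0) hne] with s hs
    exact sub_ne_zero.1 hs
  · filter_upwards [(hd.continuousAt.eventually_ne (y := 0) (sub_ne_zero.2 hSt)).filter_mono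
      nhdsWithin_le_nhds] with s hs
    exact sub_ne_zero.1 hs

theorem painleveVIAt (hcn : c = 2 * n + α + β + γ + 1) (hSt : S t ≠ t) :
    PainleveVIAt (c ^ 2 / 2) (-α ^ 2 / 2) (β ^ 2 / 2) ((1 - γ ^ 2) / 2) S t := by
  have ht0 : t ≠ 0 := ht.1.ne'
  have ht1 : t - 1 ≠ 0 := (sub_neg.2 ht.2).ne
  have da₁ := h.hasDerivAt_a₁ t ht
  have db₁ := h.hasDerivAt_b₁ t ht
  have da₂ := h.hasDerivAt_a₂ ht da₁
  have db₂ := h.hasDerivAt_b₂ ht db₁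
  have ha₁ := a₁_eq ht hc hS
  have ha₂ := h.a₂_eq ht hc hS
  have ha₂0 : a₂ t ≠ 0 := by
    rw [ha₂]
    exact div_ne_zero (mul_ne_zero hc.ne' (sub_ne_zero.2 hSt)) (mul_ne_zero ht0 ht1)
  have ha₁0 := (h.neg_one t ht).ne
  have hD₁ : D₁ t = b₁ t * (b₁ t - β) / a₁ t := by
    rw [← h.det_one t ht, mul_div_cancel_left₀ _ ha₁0]
  have hD₂ : D₂ t = b₂ t * (b₂ t - γ) / a₂ t := by
    rw [← h.det_t t ht, mul_div_cancel_left₀ _ ha₂0]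
  have hD₀ : -D₁ t - D₂ t =
      (-n - b₁ t - b₂ t) * ((-n - b₁ t - b₂ t) - α) / (-a₁ t - a₂ t) := by
    rw [← h.det_zero t ht, mul_div_cancel_left₀ _ (h.pos_zero t ht).ne']
  have ha₀ : -a₁ t - a₂ t = c * S t / t := by
    rw [ha₁, ha₂]
    field_simp
    ring
  have hderiv : deriv S =ᶠ[𝓝 t] fun s => (-a₁ s + 2 * (b₂ s * a₁ s - a₂ s * b₁ s) - γ * a₁ s
      + β * a₂ s + (1 - s) * (a₂ s * a₁ s)) / c := by
    filter_upwards [Ioo_mem_nhds ht.1 ht.2] with s hs using (h.hasDerivAt hs hc hS).deriv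
  have d2 := ((((da₁.neg.add (((db₂.mul da₁).sub (da₂.mul db₁)).const_mul 2)).sub
    (da₁.const_mul γ)).add (da₂.const_mul β)).add
    (((hasDerivAt_id t).const_sub 1).mul (da₂.mul da₁))).div_const c
  rw [PainleveVIAt, hderiv.deriv_eq, hderiv.self_of_nhds]
  refine painleveVI_algebra hcn hc.ne' ht0 ht1 (h.pos ht hc hS).ne'
    (sub_neg.2 (h.lt_one ht hc hS)).ne (sub_ne_zero.2 hSt) ha₀ ha₁ ha₂ rfl ?_ rfl rfl
    (b1 := b₁ t) (b2 := b₂ t) (b1' := (a₂ t * D₁ t - D₂ t * a₁ t) / (t - 1)) ?_ rfl ?_ ?_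
  -- The quadratic relation is the vanishing of D₀+D₁+D₂, with D₀ defined as -D₁-D₂.
  · rw [← hD₀, ← hD₁, ← hD₂]
    ring
  · rw [hD₁, hD₂]
  · field_simp
    ring
  · refine (congrArg (c * ·) (HasDerivAt.deriv d2)).trans ?_
    simp only [id, Pi.mul_apply]
    field_simp
    ring

end IsSchlesingerSystem

end System

/-! ### The orthogonal polynomials realise the Schlesinger system -/

/-- Dividing the PP entries by the norm of P and multiplying the QQ entries by it leaves the
products in the rank-one conditions unchanged. It makes a₁ equal to -R_n and normalises the relation
a₁+t a₂ = -c. -/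
theorem isSchlesingerSystem_of_isDualPair {α β γ : ℝ} (hα : 0 < α) (hβ : 0 < β) {n : ℕ}
    {μ L₀ L₁ Lt : ℝ → ℝ[X] →ₗ[ℝ] ℝ} {P Q : ℝ → ℝ[X]}
    (hsc : ∀ s ∈ Ioo (0 : ℝ) 1, IsSemiclassical α β γ s (μ s) (L₀ s) (L₁ s) (Lt s))
    (hdual : ∀ s ∈ Ioo (0 : ℝ) 1, IsDualPair (μ s) n (P s) (Q s))
    (hpos : ∀ s ∈ Ioo (0 : ℝ) 1, ∀ p : ℝ[X], p ≠ 0 → 0 < μ s (p * p))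
    (hL₀pos : ∀ s ∈ Ioo (0 : ℝ) 1, ∀ p : ℝ[X], p ≠ 0 → 0 < L₀ s (p * p))
    (hL₁neg : ∀ s ∈ Ioo (0 : ℝ) 1, ∀ p : ℝ[X], p ≠ 0 → L₁ s (p * p) < 0)
    (hμ' : ∀ s ∈ Ioo (0 : ℝ) 1, ∀ q, HasDerivAt (fun r => μ r q) (((-γ) • Lt s) q) s)
    (hL' : ∀ s ∈ Ioo (0 : ℝ) 1, ∀ q,
      HasDerivAt (fun r => L₁ r q) (((-γ / (1 - s)) • (L₁ s - Lt s)) q) s)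
    (hP' : ∀ s ∈ Ioo (0 : ℝ) 1, ∃ P', HasPolyDerivAt P P' s)
    (hQ' : ∀ s ∈ Ioo (0 : ℝ) 1, ∃ Q', HasPolyDerivAt Q Q' s) :
    IsSchlesingerSystem α β γ n (2 * n + α + β + γ + 1)
      (fun s => β * L₁ s (P s * P s) / μ s (P s * P s))
      (fun s => γ * Lt s (P s * P s) / μ s (P s * P s))
      (fun s => β * L₁ s (P s * Q s)) (fun s => γ * Lt s (P s * Q s))
      (fun s => μ s (P s * P s) * (β * L₁ s (Q s * Q s)))
      (fun s => μ s (P s * P s) * (γ * Lt s (Q s * Q s))) := by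
  have hPne : ∀ s ∈ Ioo (0 : ℝ) 1, P s ≠ 0 := fun s hs => (hdual s hs).monic.ne_zero
  have hposP : ∀ s ∈ Ioo (0 : ℝ) 1, 0 < μ s (P s * P s) := fun s hs => hpos s hs _ (hPne s hs)
  have hA₀ : ∀ s ∈ Ioo (0 : ℝ) 1, -(β * L₁ s (P s * P s) / μ s (P s * P s))
      - γ * Lt s (P s * P s) / μ s (P s * P s) = α * L₀ s (P s * P s) / μ s (P s * P s) := by
    intro s hs
    have h1 := (hsc s hs).sum_norm (hdual s hs)
    have h2 := (hposP s hs).ne'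
    field_simp
    linarith
  refine ⟨fun s hs => ?_, fun s hs => ?_, fun s hs => ?_, fun s hs => ?_, fun s hs => ?_,
    fun s hs => ?_, fun s hs => ?_, fun s hs => ?_, fun s hs => ?_⟩
  · have h1 := (hsc s hs).sum_X_norm (hdual s hs)
    have h2 := (hposP s hs).ne'
    field_simp
    linarith
  · exact div_neg_of_neg_of_pos (mul_neg_of_pos_of_neg hβ (hL₁neg s hs _ (hPne s hs))) (hposP s hs)
  · simp only [hA₀ s hs]
    exact div_pos (mul_pos hα (hL₀pos s hs _ (hPne s hs)))
      (hposP s hs)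
  · have h1 := (hdual s hs).cauchy_mul_cauchy (hsc s hs).cauchy_one
    have h2 := (hposP s hs).ne'
    field_simp
    linear_combination h1
  · have h1 := (hdual s hs).cauchy_mul_cauchy (hsc s hs).cauchy_t
    have h2 := (hposP s hs).ne'
    field_simp
    linear_combination γ ^ 2 * h1
  · have h1 := (hdual s hs).cauchy_mul_cauchy (hsc s hs).cauchy_zero
    have h2 := (hposP s hs).ne'
    have h3 := (hsc s hs).sum_mixed (hdual s hs)
    have h4 := (hsc s hs).sum_dual (hdual s hs)
    have h5 : -n - β * L₁ s (P s * Q s) - γ * Lt s (P s * Q s) = α * L₀ s (P s * Q s) := by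
      linarith
    have h6 : -(μ s (P s * P s) * (β * L₁ s (Q s * Q s))) -
        μ s (P s * P s) * (γ * Lt s (Q s * Q s)) =
        μ s (P s * P s) * (α * L₀ s (Q s * Q s)) := by
      linear_combination (-μ s (P s * P s)) * h4
    simp only [hA₀ s hs, h5, h6]
    field_simp
    linear_combination h1
  all_goals
    have hnh : Ioo (0 : ℝ) 1 ∈ 𝓝 s := Ioo_mem_nhds hs.1 hs.2
    have hs1 : 1 - s ≠ 0 := (sub_pos.2 hs.2).ne'
    obtain ⟨P', hP'⟩ := hP' s hs
    have hd : ∀ᶠ r in 𝓝 s, IsDualPair (μ r) n (P r) (Q r) := by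
      filter_upwards [hnh] with r hr using hdual r hr
    have hp : ∀ q, μ s (q * q) = 0 → q = 0 := fun q hq => by
      by_contra h0
      exact (hpos s hs q h0).ne' hq
  · have h1 := hasDerivAt_norm (hμ' s hs) hd hP'
    have h2 := hasDerivAt_cauchy_one_norm (hμ' s hs) hd hP' hp (hsc s hs) hs1 (hL' s hs)
    have h3 := (hposP s hs).ne'
    refine ((h2.const_mul β).div h1 h3).congr_deriv ?_
    rw [← neg_sub s 1]
    field_simp
    ring
  · obtain ⟨Q', hQ'⟩ := hQ' s hs
    have h1 := hasDerivAt_cauchy_one_mixed (hμ' s hs) hd hP' hp (hsc s hs) hQ' hs1 (hL' s hs)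
    have h3 := (hposP s hs).ne'
    refine (h1.const_mul β).congr_deriv ?_
    rw [← neg_sub s 1]
    field_simp
    ring
  -- b₁ + s b₂ is the subleading coefficient of P up to a constant, so its derivative is b₂.
  · refine ((hasDerivAt_subleading (hμ' s hs) hd hP').sub_const
      (if n = 0 then 1 else 0)).congr_of_eventuallyEq ?_
    filter_upwards [hnh] with r hr using (hsc r hr).sum_X_mixed (hdual r hr)

theorem mainTheorem3 (α β γ A B : ℝ) (hα : 0 < α) (hβ : 0 < β) (hγ : 0 < γ)
    (hA : 0 ≤ A) (hAB : 0 ≤ A + B) (hne : ¬(A = 0 ∧ B = 0)) (n : ℕ) :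
    ContDiffOn ℝ 2 (auxS α β γ A B n) (Ioo 0 1) ∧
    ∀ t ∈ Ioo (0 : ℝ) 1,
      auxS α β γ A B n t ≠ 0 ∧ auxS α β γ A B n t ≠ 1 ∧
      (∀ᶠ s in 𝓝[≠] t, auxS α β γ A B n s ≠ s) ∧
      (auxS α β γ A B n t ≠ t →
        PainleveVIAt ((2 * n + α + β + γ + 1) ^ 2 / 2) (-α ^ 2 / 2) (β ^ 2 / 2)
          ((1 - γ ^ 2) / 2) (auxS α β γ A B n) t) := by
  set P : ℝ → ℝ[X] := fun t => monicOP (jacobiWeight α β γ A B t) n with hP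
  set μ := momentFun A B hα hβ hγ with hμ
  set L₁ := cauchyOne A B hα hβ hγ with hL₁
  have hc : 0 < 2 * n + α + β + γ + 1 := by positivity
  have hh : ∀ t, normSqOP α β γ A B n t = μ t (P t * P t) := by
    intro t
    rw [hμ, momentFun_mul]
    simp only [normSqOP, weightForm, sq, hP]
  -- The sign comes from 1-y in the definition of R_n against x-1 in L₁.
  have hR : ∀ t, auxR α β γ A B n t = -(β * L₁ t (P t * P t) / μ t (P t * P t)) := by
    intro t
    have h1 : (∫ y in (0 : ℝ)..1, ((monicOP (jacobiWeight α β γ A B t) n).eval y) ^ 2 *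
        jacobiWeight α β γ A B t y / (1 - y)) = -L₁ t (P t * P t) := by
      rw [hL₁, cauchyOne, polyIntegral_mul, weightForm, ← intervalIntegral.integral_neg]
      congr 1
      funext y
      rw [← neg_sub y 1, div_neg]
      ring
    rw [auxR, hh, h1]
    ring
  have hS : ∀ s ∈ Ioo (0 : ℝ) 1, auxS α β γ A B n s =
      1 - (s - 1) * (β * L₁ s (P s * P s) / μ s (P s * P s)) / (2 * n + α + β + γ + 1) := by
    intro s _
    rw [auxS, hR]
    ring
  have hpos : ∀ s ∈ Ioo (0 : ℝ) 1, 0 < μ s (P s * P s) := fun s hs =>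
    momentFun_mul_self_pos hα hβ hγ hA hAB hne hs (monicOP_monic_natDegree _ n).1.ne_zero
  have hPs := fun m => isSmoothFamily_monicOP hα hβ hγ hA hAB hne m n
  have hsys := isSchlesingerSystem_of_isDualPair hα hβ (μ := μ) (L₁ := L₁)
    (fun s _ => isSemiclassical_jacobiWeight A B s hα hβ hγ)
    (fun s hs => isDualPair_jacobiWeight hα hβ hγ hA hAB hne n hs)
    (fun s hs p => momentFun_mul_self_pos hα hβ hγ hA hAB hne hs)
    (fun s hs p => cauchyZero_mul_self_pos hα hβ hγ hA hAB hne hs)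
    (fun s hs p => cauchyOne_mul_self_neg hα hβ hγ hA hAB hne hs)
    (fun s hs => hasDerivAt_momentFun A B hα hβ hγ hs)
    (fun s hs => hasDerivAt_cauchyOne A B hα hβ hγ hs)
    (fun s hs => (hPs 1).exists_hasPolyDerivAt one_ne_zero (Ioo_mem_nhds hs.1 hs.2))
    (fun s hs => (isSmoothFamily_dualOP hα hβ hγ hA hAB hne 1 n).exists_hasPolyDerivAt
      one_ne_zero (Ioo_mem_nhds hs.1 hs.2))
  refine ⟨?_, fun t ht => ⟨(hsys.pos ht hc hS).ne', (hsys.lt_one ht hc hS).ne,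
    hsys.eventually_ne ht hc hS hγ.ne', fun hSt => hsys.painleveVIAt ht hc hS rfl hSt⟩⟩
  refine ContDiffOn.congr ?_ hS
  have h1 := ((hPs 2).mul (hPs 2)).map (contDiffOn_momentFun A B hα hβ hγ 2)
  have h2 := ((hPs 2).mul (hPs 2)).map (contDiffOn_cauchyOne A B hα hβ hγ 2)
  refine contDiffOn_const.sub (ContDiffOn.div_const (ContDiffOn.mul ?_ (ContDiffOn.div
    (contDiffOn_const.mul h2) h1 fun s hs => (hpos s hs).ne')) _)
  fun_prop
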